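/- Let $V$ be a finite set. A $\tau_2$-structure on $V$ is a partition of $V$ into sets with 1 or 2 elements (equivalently, an involution of $V$, the identity being allowed). A $\tau_3$-structure on $V$ is a partition of $V$ into sets with 1, 2 or 3 elements, together with an orientation of each 2-element block (one of its two orderings) and of each 3-element block (one of its two cyclic orders). A pair of a $\tau_2$-structure and a $\tau_3$-structure on $V$ determines a directed graph on $V$ with edges labeled $a$ or $b$: each 1-element block $\{p\}$ of the $\tau_2$-structure (resp. of the $\tau_3$-structure) gives an $a$-loop (resp. a $b$-loop) at $p$; each 2-element block $\{p,q\}$ of the $\tau_2$-structure gives $a$-edges $p\to q$ and $q\to p$; each oriented 2-element block $(p,q)$ of the $\tau_3$-structure gives one $b$-edge $p\to q$; each oriented 3-element block $(p,q,r)$ gives a $b$-triangle $p\to q\to r\to p$. A finite directed graph with edges labeled in $\{a,b\}$ is called proper $\mathsf{PSL}_2(\mathbb{Z})$-cyclically reduced if it is (non-empty and) connected as an undirected graph; no two edges out of (resp. into) the same vertex have the same label; for every $a$-edge $p\to q$ there is an $a$-edge $q\to p$; for all $b$-edges $p\to q$ and $q\to r$ there is a $b$-edge $r\to p$; and every vertex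 is adjacent to an $a$-edge and to a $b$-edge. Let $G_{\mathrm{pr}}(z,u)=\sum_{n,\ell}\frac{g_{n,\ell}}{n!}z^nu^\ell$, where $g_{n,\ell}$ is the number of proper $\mathsf{PSL}_2(\mathbb{Z})$-cyclically reduced graphs with vertex set $\{1,\dots,n\}$ and $\ell$ loops, and let $\widetilde G_{\mathrm{pr}}(z,u)$ be the analogous series for the non-empty graphs that are determined by a $\tau_2$-structure and a $\tau_3$-structure. **Theorem.** The graph determined by a $\tau_2$-structure and a $\tau_3$-structure on $\{1,\dots,n\}$ is proper $\mathsf{PSL}_2(\mathbb{Z})$-cyclically reduced if and only if it is connected. Let $p_n$ be the probability that this happens for a uniformly random pair of a $\tau_2$-structure and a $\tau_3$-structure on $\{1,\dots,n\}$. Then, for all $n\ge 1$, $[z^n]\widetilde G_{\mathrm{pr}}(z,1)\neq 0$ and $$p_n=\frac{[z^n]G_{\mathrm{pr}}(z,1)}{[z^n]\widetilde G_{\mathrm{pr}}(z,1)},$$ and, as $n\to\infty$, $$p_n = 1-n^{-1/6}+\mathcal{O}\bigl(n^{-1/3}\bigr).$$ -/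

import Mathlib

open Filter Asymptotics

noncomputable section

namespace PSL2Z

/-- An `{a, b}`-labeled directed graph on the vertex set `V`: for each of the two letters, the
set of edges with this label. -/
@[ext]
structure LabeledGraph (V : Type*) where
  /-- `aEdge p q`: there is an `a`-labeled edge from `p` to `q`. -/
  aEdge : V → V → Prop
  /-- `bEdge p q`: there is a `b`-labeled edge from `p` to `q`. -/
  bEdge : V → V → Prop

namespace LabeledGraph

variable {V : Type*}

/-- The underlying undirected graph, obtained by forgetting labels and directions (and loops,
which play no role for connectedness). -/
def underlying (Γ : LabeledGraph V) : SimpleGraph V :=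
  SimpleGraph.fromRel (fun p q => Γ.aEdge p q ∨ Γ.bEdge p q)

/-- Connectedness, in the undirected sense; in particular, the graph is not empty. -/
def IsConnected (Γ : LabeledGraph V) : Prop :=
  Γ.underlying.Connected

/-- No two edges out of (resp. into) the same vertex have the same label. -/
structure IsFreelyReduced (Γ : LabeledGraph V) : Prop where
  a_out : ∀ p q r, Γ.aEdge p q → Γ.aEdge p r → q = r
  a_into : ∀ p q r, Γ.aEdge q p → Γ.aEdge r p → q = r
  b_out : ∀ p q r, Γ.bEdge p q → Γ.bEdge p r → q = r
  b_into : ∀ p q r, Γ.bEdge q p → Γ.bEdge r p → q = r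

/-- Proper `PSL₂(ℤ)`-cyclically reduced graphs. -/
structure IsProperCyclicallyReduced (Γ : LabeledGraph V) : Prop where
  connected : Γ.IsConnected
  freelyReduced : Γ.IsFreelyReduced
  a_symm : ∀ p q, Γ.aEdge p q → Γ.aEdge q p
  b_triangle : ∀ p q r, Γ.bEdge p q → Γ.bEdge q r → Γ.bEdge r p
  a_adjacent : ∀ p, ∃ q, Γ.aEdge p q ∨ Γ.aEdge q p
  b_adjacent : ∀ p, ∃ q, Γ.bEdge p q ∨ Γ.bEdge q p

/-- The total number of `a`-loops and `b`-loops. -/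
def numLoops (Γ : LabeledGraph V) : ℕ :=
  Nat.card {p : V // Γ.aEdge p p} + Nat.card {p : V // Γ.bEdge p p}

instance [Finite V] : Finite (LabeledGraph V) :=
  Finite.of_injective (fun Γ : LabeledGraph V => (Γ.aEdge, Γ.bEdge)) (by
    intro Γ Δ h
    exact LabeledGraph.ext (congrArg Prod.fst h) (congrArg Prod.snd h))

end LabeledGraph

section Structures

variable (V : Type*) [Fintype V] [DecidableEq V]

/-- A `τ₂`-structure on `V`: a partition of `V` into sets with 1 or 2 elements. (The blocks of
a `Finpartition` are non-empty.) -/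
@[ext]
structure Tau2Structure where
  partition : Finpartition (Finset.univ : Finset V)
  card_le : ∀ B ∈ partition.parts, B.card ≤ 2

variable {V}

/-- `E` is the set of directed edges of an orientation of the block `B`, which has 1, 2 or 3
elements: a loop for a 1-element set, a single directed edge (two possible choices) for a
2-element set, a directed triangle (two possible choices) for a 3-element set. -/
def IsOrientation (B : Finset V) (E : Finset (V × V)) : Prop :=
  (∃ p, B = {p} ∧ E = {(p, p)}) ∨
  (∃ p q, p ≠ q ∧ B = {p, q} ∧ E = {(p, q)}) ∨
  (∃ p q r, p ≠ q ∧ q ≠ r ∧ r ≠ p ∧ B = {p, q, r} ∧ E = {(p, q), (q, r), (r, p)})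

variable (V)

/-- A `τ₃`-structure on `V`: a partition of `V` into sets with 1, 2 or 3 elements, together with
an orientation of each of the 2- and 3-element blocks. The orientations are recorded by
the set `edges` of all directed edges of all the oriented blocks. -/
@[ext]
structure Tau3Structure where
  partition : Finpartition (Finset.univ : Finset V)
  edges : Finset (V × V)
  edges_within : ∀ e ∈ edges, ∃ B ∈ partition.parts, e.1 ∈ B ∧ e.2 ∈ B
  oriented : ∀ B ∈ partition.parts, IsOrientation B (edges ∩ (B ×ˢ B))

instance : Finite (Tau2Structure V) :=
  Finite.of_injective (fun S : Tau2Structure V => S.partition.parts) (by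
    intro S T h
    exact Tau2Structure.ext (Finpartition.ext h))

instance : Finite (Tau3Structure V) :=
  Finite.of_injective (fun S : Tau3Structure V => (S.partition.parts, S.edges)) (by
    intro S T h
    exact Tau3Structure.ext (Finpartition.ext (congrArg Prod.fst h)) (congrArg Prod.snd h))

variable {V}

/-- The graph determined by a `τ₂`-structure and a `τ₃`-structure. A block `{p}` of the
`τ₂`-structure gives an `a`-loop at `p`, a block `{p, q}` with two elements gives `a`-edges from
`p` to `q` and from `q` to `p`. The `b`-edges are the edges of the oriented blocks of the
`τ₃`-structure. -/
def graphOf (S : Tau2Structure V) (T : Tau3Structure V) : LabeledGraph V where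
  aEdge p q := ({p, q} : Finset V) ∈ S.partition.parts
  bEdge p q := (p, q) ∈ T.edges

/-- Non-empty graphs whose set of `a`-edges (resp. `b`-edges) is determined by a
`τ₂`-structure (resp. a `τ₃`-structure). -/
def LabeledGraph.IsDetermined (Γ : LabeledGraph V) : Prop :=
  Nonempty V ∧ ∃ (S : Tau2Structure V) (T : Tau3Structure V), Γ = graphOf S T

end Structures

/-- The probability that a uniformly random pair of a `τ₂`-structure and a `τ₃`-structure on `n`
labeled vertices determines a proper `PSL₂(ℤ)`-cyclically reduced graph. -/
def prob (n : ℕ) : ℝ :=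
  (Nat.card {x : Tau2Structure (Fin n) × Tau3Structure (Fin n) //
      (graphOf x.1 x.2).IsProperCyclicallyReduced} : ℝ) /
    (Nat.card (Tau2Structure (Fin n) × Tau3Structure (Fin n)) : ℝ)

/-- The bivariate exponential generating series `∑ c(n, ℓ) zⁿ uˡ / n!` of a class of finite labeled
graphs, as a power series in `z` whose coefficients are polynomials in `u`. Here `c(n, ℓ)`
is the number of graphs in the class with vertex set `Fin n` and `ℓ` loops (so `ℓ ≤ 2 * n`). -/
def egs (C : (n : ℕ) → LabeledGraph (Fin n) → Prop) : PowerSeries (Polynomial ℝ) :=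
  PowerSeries.mk fun n => ∑ l ∈ Finset.range (2 * n + 1),
    Polynomial.monomial l
      ((Nat.card {Γ : LabeledGraph (Fin n) // C n Γ ∧ Γ.numLoops = l} : ℝ) / (n.factorial : ℝ))

/-- The series `G_pr(z, u)` of labeled proper `PSL₂(ℤ)`-cyclically reduced graphs. -/
def Gpr : PowerSeries (Polynomial ℝ) :=
  egs fun _ Γ => Γ.IsProperCyclicallyReduced

/-- The series of non-empty labeled graphs determined by a `τ₂`- and a `τ₃`-structure. -/
def GprTilde : PowerSeries (Polynomial ℝ) :=
  egs fun _ Γ => Γ.IsDetermined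

/-- Setting `u = 1` in a bivariate series. -/
def atOne (F : PowerSeries (Polynomial ℝ)) : PowerSeries ℝ :=
  PowerSeries.map (Polynomial.evalRingHom 1) F

end PSL2Z

end

noncomputable section

namespace PSL2Z

/-! Pairs of a $\tau_2$- and a $\tau_3$-structure are the same thing as graphs satisfying every
condition of a proper cyclically reduced graph except connectedness. Hence $p_n$ is the proportion
of connected graphs in a class closed under disjoint unions and components.

Let $t_n$, $s_n$ count the two kinds of structures and put $\alpha_n=t_ns_n/n!$ (`pairCoeff`).
Splitting off the component of a root (`count_fin_succ`) gives, with no division of power series,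
$\alpha_n=\sum_{j=1}^{n}\frac jn\,p_j\,\alpha_j\,\alpha_{n-j}$ (`pairCoeff_succ`). The same
splitting, applied to graphs with only $a$-edges or only $b$-edges, gives the recurrences of $t_n$
and $s_n$.

Elementary estimates replace the saddle point method. The recurrence gives
$t_n/t_{n+1}=n^{-1/2}+O(n^{-1})$ by induction. The coefficients $c_n=s_n/n!$ of $\exp(z+z^2+z^3/3)$
satisfy $c_n/c_{n+1}=n^{1/3}+O(1)$: a Cauchy–Schwarz inequality bounds the increments of these
quotients, and the recurrence then pins them down (`quotient_bounds_of_recurrence`). So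
$w_n=\alpha_n/\alpha_{n+1}=(n+1)^{-1/6}+O(n^{-1/2})$.

Divide the convolution by $\alpha_n$. The term $j=n$ is $p_n$, the term $j=n-1$ is
$(1-\frac1n)p_{n-1}w_{n-1}$, and $j=1$ is negligible. The rest decays geometrically from both ends
towards the middle, and its end terms contain two factors $w$, so it is $O(n^{-1/3})$
(`exists_sum_mul_div_le`). Thus $1-p_n=(1-\frac1n)p_{n-1}w_{n-1}+O(n^{-1/3})$. This first yields
$1-p_n=O(n^{-1/6})$; inserting that for $p_{n-1}$ yields the theorem. -/

/-- A property of binary relations which is invariant under bijections and which holds for a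
disjoint union if and only if it holds for both parts. -/
structure IsLocal (P : ∀ V : Type, (V → V → Prop) → Prop) : Prop where
  comap : ∀ (V W : Type) (e : V ≃ W) (R : W → W → Prop), P W R → P V fun p q => R (e p) (e q)
  sum : ∀ (V W : Type) (R : V → V → Prop) (S : W → W → Prop),
    P (V ⊕ W) (Sum.LiftRel R S) ↔ P V R ∧ P W S

/-! ### Reachability, isomorphisms and disjoint unions of labeled graphs -/

namespace LabeledGraph

/-- The graph on `V` induced by a map `V → W` and a graph on `W`. -/
@[simps]
def comap {V W : Type*} (f : V → W) (Γ : LabeledGraph W) : LabeledGraph V where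
  aEdge p q := Γ.aEdge (f p) (f q)
  bEdge p q := Γ.bEdge (f p) (f q)

/-- The disjoint union of two labeled graphs. -/
@[simps]
def disjointSum {V W : Type*} (Γ : LabeledGraph V) (Δ : LabeledGraph W) :
    LabeledGraph (V ⊕ W) where
  aEdge := Sum.LiftRel Γ.aEdge Δ.aEdge
  bEdge := Sum.LiftRel Γ.bEdge Δ.bEdge

/-- The `a`-edges and the `b`-edges have given properties. -/
def HasProps (P Q : ∀ V : Type, (V → V → Prop) → Prop) {V : Type} (Γ : LabeledGraph V) : Prop :=
  P V Γ.aEdge ∧ Q V Γ.bEdge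

theorem underlying_adj {V : Type*} {Γ : LabeledGraph V} {p q : V} :
    Γ.underlying.Adj p q ↔
      p ≠ q ∧ ((Γ.aEdge p q ∨ Γ.bEdge p q) ∨ Γ.aEdge q p ∨ Γ.bEdge q p) := by
  simp [underlying]

theorem reachable_of_edge {V : Type*} {Γ : LabeledGraph V} {p q : V}
    (h : (Γ.aEdge p q ∨ Γ.bEdge p q) ∨ Γ.aEdge q p ∨ Γ.bEdge q p) :
    Γ.underlying.Reachable p q := by
  by_cases hpq : p = q
  · rw [hpq]
  · exact (underlying_adj.2 ⟨hpq, h⟩).reachable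

/-- A set of vertices which is closed under adjacency is closed under reachability. -/
theorem mem_of_reachable {V : Type*} {Γ : LabeledGraph V} {s : V → Prop}
    (hs : ∀ p q, Γ.underlying.Adj p q → s p → s q) {p q : V}
    (h : Γ.underlying.Reachable p q) (hp : s p) : s q := by
  rw [SimpleGraph.reachable_iff_reflTransGen] at h
  induction h with
  | refl => exact hp
  | tail _ hadj ih => exact hs _ _ hadj ih

/-- The underlying graphs of isomorphic labeled graphs are isomorphic. -/
def underlyingIso {V W : Type*} (e : V ≃ W) (Γ : LabeledGraph W) :
    (Γ.comap e).underlying ≃g Γ.underlying where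
  toEquiv := e
  map_rel_iff' := by
    intro p q
    simp [underlying_adj]

theorem isConnected_comap {V W : Type*} (e : V ≃ W) (Γ : LabeledGraph W) :
    (Γ.comap e).IsConnected ↔ Γ.IsConnected :=
  (underlyingIso e Γ).connected_iff

theorem reachable_comap {V W : Type*} (e : V ≃ W) (Γ : LabeledGraph W) {p q : V} :
    (Γ.comap e).underlying.Reachable p q ↔ Γ.underlying.Reachable (e p) (e q) :=
  ((underlyingIso e Γ).reachable_iff).symm

/-- Transport of labeled graphs along a bijection of the vertex sets. -/
@[simps]
def comapEquiv {V W : Type*} (e : V ≃ W) : LabeledGraph W ≃ LabeledGraph V where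
  toFun := comap e
  invFun := comap e.symm
  left_inv Γ := by ext <;> simp
  right_inv Γ := by ext <;> simp

theorem reachable_disjointSum_inl {V W : Type*} {Γ : LabeledGraph V} {Δ : LabeledGraph W}
    {p q : V} :
    (Γ.disjointSum Δ).underlying.Reachable (Sum.inl p) (Sum.inl q) ↔
      Γ.underlying.Reachable p q := by
  constructor
  · intro h
    have := mem_of_reachable (s := fun z => ∀ q, z = Sum.inl q → Γ.underlying.Reachable p q)
      (Γ := Γ.disjointSum Δ) ?_ h ?_
    · exact this q rfl
    · rintro (x | x) (y | y) hadj hx z hz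
      · obtain rfl : y = z := by simpa using hz
        refine (hx x rfl).trans (reachable_of_edge ?_)
        simpa using (underlying_adj.1 hadj).2
      · cases hz
      · simpa using (underlying_adj.1 hadj).2
      · cases hz
    · intro z hz
      obtain rfl : p = z := by simpa using hz
      rfl
  · intro h
    refine mem_of_reachable
      (s := fun z => (Γ.disjointSum Δ).underlying.Reachable (Sum.inl p) (Sum.inl z)) ?_ h
      (SimpleGraph.Reachable.refl _)
    intro x y hxy hx
    refine hx.trans (reachable_of_edge ?_)
    simpa using (underlying_adj.1 hxy).2

theorem not_reachable_disjointSum {V W : Type*} {Γ : LabeledGraph V} {Δ : LabeledGraph W}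
    {p : V} {q : W} :
    ¬ (Γ.disjointSum Δ).underlying.Reachable (Sum.inl p) (Sum.inr q) := by
  intro h
  have := mem_of_reachable (s := fun z => ∃ r, z = Sum.inl r) (Γ := Γ.disjointSum Δ) ?_ h ⟨p, rfl⟩
  · simp at this
  · rintro (x | x) (y | y) hadj hx
    · exact ⟨y, rfl⟩
    · simpa using (underlying_adj.1 hadj).2
    · exact ⟨y, rfl⟩
    · simp at hx

end LabeledGraph

/-! ### Counting by the component of a root -/

open LabeledGraph

/-- The number of labeled graphs on `V` with given properties of the edges. -/
def count (P Q : ∀ V : Type, (V → V → Prop) → Prop) (V : Type) : ℕ :=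
  Nat.card {Γ : LabeledGraph V // Γ.HasProps P Q}

/-- The number of connected labeled graphs on `V` with given properties of the edges. -/
def connCount (P Q : ∀ V : Type, (V → V → Prop) → Prop) (V : Type) : ℕ :=
  Nat.card {Γ : LabeledGraph V // Γ.HasProps P Q ∧ Γ.IsConnected}

variable {P Q : ∀ V : Type, (V → V → Prop) → Prop}

theorem IsLocal.comap_iff (hP : IsLocal P) {V W : Type} (e : V ≃ W) (R : W → W → Prop) :
    P V (fun p q => R (e p) (e q)) ↔ P W R := by
  refine ⟨fun h => ?_, hP.comap V W e R⟩
  simpa using hP.comap W V e.symm _ h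

theorem hasProps_comap (hP : IsLocal P) (hQ : IsLocal Q) {V W : Type} (e : V ≃ W)
    (Γ : LabeledGraph W) : (Γ.comap e).HasProps P Q ↔ Γ.HasProps P Q :=
  and_congr (hP.comap_iff e _) (hQ.comap_iff e _)

theorem hasProps_disjointSum (hP : IsLocal P) (hQ : IsLocal Q) {V W : Type}
    (Γ : LabeledGraph V) (Δ : LabeledGraph W) :
    (Γ.disjointSum Δ).HasProps P Q ↔ Γ.HasProps P Q ∧ Δ.HasProps P Q := by
  have h1 := hP.sum V W Γ.aEdge Δ.aEdge
  have h2 := hQ.sum V W Γ.bEdge Δ.bEdge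
  unfold HasProps
  rw [disjointSum, h1, h2, and_and_and_comm]

theorem count_congr (hP : IsLocal P) (hQ : IsLocal Q) {V W : Type} (e : V ≃ W) :
    count P Q V = count P Q W :=
  (Nat.card_congr ((comapEquiv e).subtypeEquiv fun Γ => (hasProps_comap hP hQ e Γ).symm)).symm

theorem connCount_congr (hP : IsLocal P) (hQ : IsLocal Q) {V W : Type} (e : V ≃ W) :
    connCount P Q V = connCount P Q W :=
  (Nat.card_congr ((comapEquiv e).subtypeEquiv fun Γ =>
    (and_congr (hasProps_comap hP hQ e Γ) (isConnected_comap e Γ)).symm)).symm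

/-- A graph on `V ⊕ W` in which the component of a vertex `v` in `V` is `V` consists of a
connected graph on `V` and a graph on `W`. -/
def componentEquiv (hP : IsLocal P) (hQ : IsLocal Q) (V W : Type) (v : V) :
    {Γ : LabeledGraph (V ⊕ W) // Γ.HasProps P Q ∧
      (∀ p, Γ.underlying.Reachable (Sum.inl v) (Sum.inl p)) ∧
      ∀ q, ¬ Γ.underlying.Reachable (Sum.inl v) (Sum.inr q)} ≃
    {Γ : LabeledGraph V // Γ.HasProps P Q ∧ Γ.IsConnected} ×
      {Γ : LabeledGraph W // Γ.HasProps P Q} := by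
  have key : ∀ Γ : LabeledGraph (V ⊕ W),
      (∀ p, Γ.underlying.Reachable (Sum.inl v) (Sum.inl p)) →
      (∀ q, ¬ Γ.underlying.Reachable (Sum.inl v) (Sum.inr q)) →
      (Γ.comap Sum.inl).disjointSum (Γ.comap Sum.inr) = Γ := by
    intro Γ h1 h2
    -- An edge between the two sides would make a vertex of `W` reachable from `v`.
    have hcross : ∀ p q, ¬ ((Γ.aEdge (Sum.inl p) (Sum.inr q) ∨ Γ.bEdge (Sum.inl p) (Sum.inr q)) ∨
        Γ.aEdge (Sum.inr q) (Sum.inl p) ∨ Γ.bEdge (Sum.inr q) (Sum.inl p)) :=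
      fun p q h => h2 q ((h1 p).trans (reachable_of_edge h))
    simp only [not_or] at hcross
    ext (p | p) (q | q) <;> simp [hcross]
  refine
    { toFun := fun Γ => (⟨Γ.1.comap Sum.inl, ?_⟩, ⟨Γ.1.comap Sum.inr, ?_⟩)
      invFun := fun x => ⟨x.1.1.disjointSum x.2.1, ?_⟩
      left_inv := ?_
      right_inv := ?_ }
  · obtain ⟨Γ, h, h1, h2⟩ := Γ
    have hk := key Γ h1 h2
    rw [← hk, hasProps_disjointSum hP hQ] at h
    refine ⟨h.1, ?_⟩
    rw [← hk] at h1
    simp only [reachable_disjointSum_inl] at h1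
    have : Nonempty V := ⟨v⟩
    exact ⟨fun p q => (h1 p).symm.trans (h1 q)⟩
  · obtain ⟨Γ, h, h1, h2⟩ := Γ
    have hk := key Γ h1 h2
    rw [← hk, hasProps_disjointSum hP hQ] at h
    exact h.2
  · refine ⟨(hasProps_disjointSum hP hQ _ _).2 ⟨x.1.2.1, x.2.2⟩, fun p => ?_, fun q => ?_⟩
    · exact reachable_disjointSum_inl.2 (x.1.2.2.preconnected v p)
    · exact not_reachable_disjointSum
  · rintro ⟨Γ, h, h1, h2⟩
    exact Subtype.ext (key Γ h1 h2)
  · rintro ⟨⟨Γ, hΓ⟩, ⟨Δ, hΔ⟩⟩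
    refine Prod.ext (Subtype.ext ?_) (Subtype.ext ?_) <;> ext <;> simp

open Classical in
/-- The decomposition according to the component of a distinguished vertex. -/
theorem count_option (hP : IsLocal P) (hQ : IsLocal Q) (W : Type) [Fintype W] :
    count P Q (Option W) =
      ∑ S : Finset W, connCount P Q (Option {w // w ∈ S}) * count P Q {w // w ∉ S} := by
  -- The root is `none`; graphs are sorted by the set of the other vertices in its component.
  let f : {Γ : LabeledGraph (Option W) // Γ.HasProps P Q} → Finset W := fun Γ =>
    Finset.univ.filter fun w => Γ.1.underlying.Reachable none (some w)
  rw [count, ← Nat.card_congr (Equiv.sigmaFiberEquiv f), Nat.card_sigma]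
  refine Finset.sum_congr rfl fun S _ => ?_
  rw [connCount, count, ← Nat.card_prod,
    ← Nat.card_congr (componentEquiv hP hQ (Option {w // w ∈ S}) {w // w ∉ S} none)]
  let e : Option {w // w ∈ S} ⊕ {w // w ∉ S} ≃ Option W :=
    { toFun := Sum.elim (Option.map Subtype.val) fun w => some w.1
      invFun := fun o => o.elim (Sum.inl none) fun w =>
        if h : w ∈ S then Sum.inl (some ⟨w, h⟩) else Sum.inr ⟨w, h⟩
      left_inv := by
        rintro ((_ | ⟨w, hw⟩) | ⟨w, hw⟩)
        · rfl
        · simp [hw]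
        · simp [hw]
      right_inv := by
        rintro (_ | w)
        · rfl
        · by_cases hw : w ∈ S <;> simp [hw] }
  refine Nat.card_congr ((Equiv.subtypeSubtypeEquivSubtypeInter _
    (fun Γ : LabeledGraph (Option W) => (Finset.univ.filter fun w =>
      Γ.underlying.Reachable none (some w)) = S)).trans
    ((comapEquiv e).subtypeEquiv fun Γ => ?_))
  rw [comapEquiv_apply, hasProps_comap hP hQ]
  refine and_congr_right fun _ => ?_
  simp only [reachable_comap, Finset.ext_iff, Finset.mem_filter, Finset.mem_univ, true_and]
  constructor
  · intro h
    refine ⟨?_, fun q => ?_⟩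
    · rintro (_ | ⟨w, hw⟩)
      · rfl
      · exact (h w).2 hw
    · exact fun hq => q.2 ((h q.1).1 hq)
  · rintro ⟨h1, h2⟩ w
    refine ⟨fun h => ?_, fun hw => h1 (some ⟨w, hw⟩)⟩
    by_contra hw
    exact h2 ⟨w, hw⟩ h

/-- A summand of `count_option` depends only on the size of the set, and `n.choose k` sets have size
`k`. The component has `k + 1` vertices because it also contains the root. -/
theorem count_fin_succ (hP : IsLocal P) (hQ : IsLocal Q) (n : ℕ) :
    count P Q (Fin (n + 1)) = ∑ k ∈ Finset.range (n + 1),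
      n.choose k * (connCount P Q (Fin (k + 1)) * count P Q (Fin (n - k))) := by
  classical
  rw [count_congr hP hQ (finSuccEquiv n), count_option hP hQ]
  have : ∀ S : Finset (Fin n), connCount P Q (Option {w // w ∈ S}) * count P Q {w // w ∉ S} =
      connCount P Q (Fin (S.card + 1)) * count P Q (Fin (n - S.card)) := by
    intro S
    rw [connCount_congr hP hQ (Fintype.equivFinOfCardEq (n := S.card + 1) (by simp)),
      count_congr hP hQ (Fintype.equivFinOfCardEq (α := {w // w ∉ S}) (n := n - S.card)
        (by simp [Fintype.card_subtype_compl]))]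
  simp only [this]
  have h := Finset.sum_powerset_apply_card
    (fun k => connCount P Q (Fin (k + 1)) * count P Q (Fin (n - k)))
    (x := (Finset.univ : Finset (Fin n)))
  simpa using h

/-! ### The edge conditions and their compatibility with disjoint unions -/

/-- The conditions on the `a`-edges of a proper `PSL₂(ℤ)`-cyclically reduced graph. -/
structure IsTau2Relation (V : Type) (R : V → V → Prop) : Prop where
  out : ∀ p q r, R p q → R p r → q = r
  symm : ∀ p q, R p q → R q p
  adjacent : ∀ p, ∃ q, R p q

/-- The conditions on the `b`-edges of a proper `PSL₂(ℤ)`-cyclically reduced graph. -/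
structure IsTau3Relation (V : Type) (R : V → V → Prop) : Prop where
  out : ∀ p q r, R p q → R p r → q = r
  into : ∀ p q r, R q p → R r p → q = r
  triangle : ∀ p q r, R p q → R q r → R r p
  adjacent : ∀ p, ∃ q, R p q ∨ R q p

/-- The relation without related pairs. -/
def IsEmptyRelation (V : Type) (R : V → V → Prop) : Prop :=
  ∀ p q, ¬ R p q

theorem isLocal_isTau2Relation : IsLocal IsTau2Relation where
  comap V W e R h :=
    { out := fun p q r h1 h2 => e.injective (h.out _ _ _ h1 h2)
      symm := fun p q h1 => h.symm _ _ h1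
      adjacent := fun p => by
        obtain ⟨q, hq⟩ := h.adjacent (e p)
        exact ⟨e.symm q, by simpa using hq⟩ }
  sum V W R S := by
    constructor
    · intro h
      refine ⟨⟨fun p q r h1 h2 => ?_, fun p q h1 => ?_, fun p => ?_⟩,
        ⟨fun p q r h1 h2 => ?_, fun p q h1 => ?_, fun p => ?_⟩⟩
      · simpa using h.out (Sum.inl p) (Sum.inl q) (Sum.inl r) (by simpa) (by simpa)
      · simpa using h.symm (Sum.inl p) (Sum.inl q) (by simpa)
      · simpa using h.adjacent (Sum.inl p)
      · simpa using h.out (Sum.inr p) (Sum.inr q) (Sum.inr r) (by simpa) (by simpa)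
      · simpa using h.symm (Sum.inr p) (Sum.inr q) (by simpa)
      · simpa using h.adjacent (Sum.inr p)
    · rintro ⟨h, h'⟩
      refine ⟨?_, ?_, ?_⟩
      · rintro (p | p) (q | q) (r | r) <;> simp <;> first | exact h.out _ _ _ | exact h'.out _ _ _
      · rintro (p | p) (q | q) <;> simp <;> first | exact h.symm _ _ | exact h'.symm _ _
      · rintro (p | p) <;> simp [h.adjacent, h'.adjacent]

theorem isLocal_isTau3Relation : IsLocal IsTau3Relation where
  comap V W e R h :=
    { out := fun p q r h1 h2 => e.injective (h.out _ _ _ h1 h2)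
      into := fun p q r h1 h2 => e.injective (h.into _ _ _ h1 h2)
      triangle := fun p q r h1 h2 => h.triangle _ _ _ h1 h2
      adjacent := fun p => by
        obtain ⟨q, hq⟩ := h.adjacent (e p)
        exact ⟨e.symm q, by simpa using hq⟩ }
  sum V W R S := by
    constructor
    · intro h
      refine ⟨⟨fun p q r h1 h2 => ?_, fun p q r h1 h2 => ?_, fun p q r h1 h2 => ?_, fun p => ?_⟩,
        ⟨fun p q r h1 h2 => ?_, fun p q r h1 h2 => ?_, fun p q r h1 h2 => ?_, fun p => ?_⟩⟩
      · simpa using h.out (Sum.inl p) (Sum.inl q) (Sum.inl r) (by simpa) (by simpa)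
      · simpa using h.into (Sum.inl p) (Sum.inl q) (Sum.inl r) (by simpa) (by simpa)
      · simpa using h.triangle (Sum.inl p) (Sum.inl q) (Sum.inl r) (by simpa) (by simpa)
      · simpa using h.adjacent (Sum.inl p)
      · simpa using h.out (Sum.inr p) (Sum.inr q) (Sum.inr r) (by simpa) (by simpa)
      · simpa using h.into (Sum.inr p) (Sum.inr q) (Sum.inr r) (by simpa) (by simpa)
      · simpa using h.triangle (Sum.inr p) (Sum.inr q) (Sum.inr r) (by simpa) (by simpa)
      · simpa using h.adjacent (Sum.inr p)
    · rintro ⟨h, h'⟩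
      refine ⟨?_, ?_, ?_, ?_⟩
      · rintro (p | p) (q | q) (r | r) <;> simp <;> first | exact h.out _ _ _ | exact h'.out _ _ _
      · rintro (p | p) (q | q) (r | r) <;> simp <;>
          first | exact h.into _ _ _ | exact h'.into _ _ _
      · rintro (p | p) (q | q) (r | r) <;> simp <;>
          first | exact h.triangle _ _ _ | exact h'.triangle _ _ _
      · rintro (p | p) <;> simp [h.adjacent, h'.adjacent]

theorem isLocal_isEmptyRelation : IsLocal IsEmptyRelation where
  comap V W e R h := fun p q => h _ _
  sum V W R S := by simp [IsEmptyRelation]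

theorem isProperCyclicallyReduced_iff {V : Type} (Γ : LabeledGraph V) :
    Γ.IsProperCyclicallyReduced ↔
      Γ.HasProps IsTau2Relation IsTau3Relation ∧ Γ.IsConnected := by
  constructor
  · intro h
    refine ⟨⟨⟨h.freelyReduced.a_out, h.a_symm, fun p => ?_⟩,
      ⟨h.freelyReduced.b_out, h.freelyReduced.b_into, h.b_triangle, h.b_adjacent⟩⟩, h.connected⟩
    obtain ⟨q, hq | hq⟩ := h.a_adjacent p
    · exact ⟨q, hq⟩
    · exact ⟨q, h.a_symm _ _ hq⟩
  · rintro ⟨⟨ha, hb⟩, hc⟩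
    exact ⟨hc, ⟨ha.out, fun p q r h1 h2 => ha.out p q r (ha.symm _ _ h1) (ha.symm _ _ h2),
      hb.out, hb.into⟩, ha.symm, hb.triangle,
      fun p => (ha.adjacent p).imp fun _ h => Or.inl h, hb.adjacent⟩

/-! ### Structures as relations -/

theorem IsOrientation.out {V : Type*} [DecidableEq V] {B : Finset V} {E : Finset (V × V)}
    (h : IsOrientation B E)
    {p q r : V} (h1 : (p, q) ∈ E) (h2 : (p, r) ∈ E) : q = r := by
  rcases h with ⟨x, rfl, rfl⟩ | ⟨x, y, hxy, rfl, rfl⟩ | ⟨x, y, z, hxy, hyz, hzx, rfl, rfl⟩ <;>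
    simp at h1 h2 <;> grind

theorem IsOrientation.into {V : Type*} [DecidableEq V] {B : Finset V} {E : Finset (V × V)}
    (h : IsOrientation B E)
    {p q r : V} (h1 : (q, p) ∈ E) (h2 : (r, p) ∈ E) : q = r := by
  rcases h with ⟨x, rfl, rfl⟩ | ⟨x, y, hxy, rfl, rfl⟩ | ⟨x, y, z, hxy, hyz, hzx, rfl, rfl⟩ <;>
    simp at h1 h2 <;> grind

theorem IsOrientation.triangle {V : Type*} [DecidableEq V] {B : Finset V} {E : Finset (V × V)}
    (h : IsOrientation B E)
    {p q r : V} (h1 : (p, q) ∈ E) (h2 : (q, r) ∈ E) : (r, p) ∈ E := by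
  rcases h with ⟨x, rfl, rfl⟩ | ⟨x, y, hxy, rfl, rfl⟩ | ⟨x, y, z, hxy, hyz, hzx, rfl, rfl⟩ <;>
    simp at h1 h2 ⊢ <;> grind

theorem IsOrientation.adjacent {V : Type*} [DecidableEq V] {B : Finset V} {E : Finset (V × V)}
    (h : IsOrientation B E)
    {p : V} (hp : p ∈ B) : ∃ q, (p, q) ∈ E ∨ (q, p) ∈ E := by
  rcases h with ⟨x, rfl, rfl⟩ | ⟨x, y, hxy, rfl, rfl⟩ | ⟨x, y, z, hxy, hyz, hzx, rfl, rfl⟩ <;>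
    simp at hp ⊢ <;> grind

/-- An edge or a triangle is complete as an undirected graph. This is why the edges of a
$\tau_3$-structure determine its blocks. -/
theorem IsOrientation.mem_or_mem {V : Type*} [DecidableEq V] {B : Finset V} {E : Finset (V × V)}
    (h : IsOrientation B E)
    {p q : V} (hp : p ∈ B) (hq : q ∈ B) (hpq : p ≠ q) : (p, q) ∈ E ∨ (q, p) ∈ E := by
  rcases h with ⟨x, rfl, rfl⟩ | ⟨x, y, hxy, rfl, rfl⟩ | ⟨x, y, z, hxy, hyz, hzx, rfl, rfl⟩ <;>
    simp at hp hq ⊢ <;> grind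

/-- Graphs with given properties as pairs of relations. -/
def hasPropsEquiv (P Q : ∀ V : Type, (V → V → Prop) → Prop) (V : Type) :
    {Γ : LabeledGraph V // Γ.HasProps P Q} ≃
      {R : V → V → Prop // P V R} × {R : V → V → Prop // Q V R} where
  toFun Γ := (⟨Γ.1.aEdge, Γ.2.1⟩, ⟨Γ.1.bEdge, Γ.2.2⟩)
  invFun x := ⟨⟨x.1.1, x.2.1⟩, x.1.2, x.2.2⟩

/-- The pairs of related elements. -/
def edgeSet {V : Type*} [Fintype V] (R : V → V → Prop) : Finset (V × V) :=
  open Classical in Finset.univ.filter fun x => R x.1 x.2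

@[simp]
theorem mem_edgeSet {V : Type*} [Fintype V] {R : V → V → Prop} {x : V × V} :
    x ∈ edgeSet R ↔ R x.1 x.2 := by
  simp [edgeSet]

variable {V : Type} [Fintype V] [DecidableEq V]

theorem Tau2Structure.isTau2Relation (S : Tau2Structure V) :
    IsTau2Relation V fun p q => ({p, q} : Finset V) ∈ S.partition.parts where
  out p q r h1 h2 := by
    have h : ({p, q} : Finset V) = {p, r} :=
      S.partition.eq_of_mem_parts h1 h2 (Finset.mem_insert_self _ _) (Finset.mem_insert_self _ _)
    have hq : q ∈ ({p, r} : Finset V) := h ▸ by simp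
    have hr : r ∈ ({p, q} : Finset V) := h ▸ by simp
    simp only [Finset.mem_insert, Finset.mem_singleton] at hq hr
    grind
  symm p q h := by rwa [Finset.pair_comm]
  adjacent p := by
    obtain ⟨B, hB, hp⟩ := S.partition.exists_mem (Finset.mem_univ p)
    have hc := S.card_le B hB
    have hpos : 0 < B.card := Finset.card_pos.2 ⟨p, hp⟩
    obtain h1 | h2 : B.card = 1 ∨ B.card = 2 := by omega
    · obtain ⟨q, rfl⟩ := Finset.card_eq_one.1 h1
      obtain rfl : p = q := by simpa using hp
      exact ⟨p, by simpa using hB⟩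
    · obtain ⟨x, y, -, rfl⟩ := Finset.card_eq_two.1 h2
      obtain rfl | rfl : p = x ∨ p = y := by simpa using hp
      · exact ⟨y, hB⟩
      · exact ⟨x, by rwa [Finset.pair_comm]⟩

/-- The partition is recovered from its relation, which gives injectivity of `tau2Equiv`;
one-element blocks are covered by `p = q`. -/
theorem Tau2Structure.mem_parts_iff (S : Tau2Structure V) (B : Finset V) :
    B ∈ S.partition.parts ↔ ∃ p q, {p, q} ∈ S.partition.parts ∧ B = {p, q} := by
  constructor
  · intro hB
    obtain ⟨p, hp⟩ := S.partition.nonempty_of_mem_parts hB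
    obtain ⟨q, hq⟩ := S.isTau2Relation.adjacent p
    exact ⟨p, q, hq, S.partition.eq_of_mem_parts hB hq hp (by simp)⟩
  · rintro ⟨p, q, h, rfl⟩
    exact h

theorem exists_tau2Structure {R : V → V → Prop} (hR : IsTau2Relation V R) :
    ∃ S : Tau2Structure V, (fun p q => ({p, q} : Finset V) ∈ S.partition.parts) = R := by
  classical
  -- An unordered pair fixes its elements only up to exchange, so the symmetry of `R` is needed.
  have hpair : ∀ x y p q, R x y → ({x, y} : Finset V) = {p, q} → R p q := by
    intro x y p q hxy h
    have hp : p ∈ ({x, y} : Finset V) := h ▸ by simp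
    have hq : q ∈ ({x, y} : Finset V) := h ▸ by simp
    have hx : x ∈ ({p, q} : Finset V) := h ▸ by simp
    have hy : y ∈ ({p, q} : Finset V) := h ▸ by simp
    simp only [Finset.mem_insert, Finset.mem_singleton] at hp hq hx hy
    have := hR.symm _ _ hxy
    grind
  refine ⟨⟨Finpartition.ofExistsUnique
    ((Finset.univ.filter fun x : V × V => R x.1 x.2).image fun x => {x.1, x.2}) ?_ ?_ ?_, ?_⟩, ?_⟩
  · simp
  · intro p _
    obtain ⟨q, hq⟩ := hR.adjacent p
    refine ⟨{p, q}, ⟨Finset.mem_image.2 ⟨(p, q), by simpa using hq, rfl⟩, by simp⟩, ?_⟩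
    rintro B ⟨hB, hp⟩
    obtain ⟨⟨x, y⟩, hxy, rfl⟩ := Finset.mem_image.1 hB
    have hxy' : R x y := by simpa using hxy
    obtain rfl | rfl : p = x ∨ p = y := by simpa using hp
    · rw [hR.out _ _ _ hxy' hq]
    · rw [hR.out _ _ _ (hR.symm _ _ hxy') hq, Finset.pair_comm]
  · simp only [Finset.mem_image, Finset.mem_filter, Finset.mem_univ, true_and, not_exists, not_and]
    rintro ⟨x, y⟩ -
    exact Finset.insert_ne_empty _ _
  · intro B hB
    obtain ⟨⟨x, y⟩, -, rfl⟩ := Finset.mem_image.1 hB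
    exact Finset.card_le_two
  · ext p q
    simp only [Finpartition.ofExistsUnique, Finset.mem_image, Finset.mem_filter, Finset.mem_univ,
      true_and, Prod.exists]
    exact ⟨fun ⟨x, y, hxy, h⟩ => hpair x y p q hxy h, fun h => ⟨p, q, h, rfl⟩⟩

/-- `τ₂`-structures correspond to their relations. -/
def tau2Equiv (V : Type) [Fintype V] [DecidableEq V] :
    Tau2Structure V ≃ {R : V → V → Prop // IsTau2Relation V R} :=
  Equiv.ofBijective (fun S => ⟨_, S.isTau2Relation⟩) ⟨by
    intro S T h
    have h' := fun p q => iff_of_eq (congrFun (congrFun (congrArg Subtype.val h) p) q)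
    refine Tau2Structure.ext (Finpartition.ext (Finset.ext fun B => ?_))
    rw [S.mem_parts_iff, T.mem_parts_iff]
    exact exists₂_congr fun p q => and_congr_left fun _ => h' p q, by
    rintro ⟨R, hR⟩
    obtain ⟨S, hS⟩ := exists_tau2Structure hR
    exact ⟨S, Subtype.ext hS⟩⟩

theorem Tau3Structure.mem_of_mem (T : Tau3Structure V) {B : Finset V}
    (hB : B ∈ T.partition.parts) {p q : V} (h : (p, q) ∈ T.edges) : p ∈ B ↔ q ∈ B := by
  obtain ⟨B', hB', hp, hq⟩ := T.edges_within _ h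
  constructor
  · intro h
    rwa [T.partition.eq_of_mem_parts hB hB' h hp]
  · intro h
    rwa [T.partition.eq_of_mem_parts hB hB' h hq]

theorem Tau3Structure.isTau3Relation (T : Tau3Structure V) :
    IsTau3Relation V fun p q => (p, q) ∈ T.edges where
  out p q r h1 h2 := by
    obtain ⟨B, hB, hp⟩ := T.partition.exists_mem (Finset.mem_univ p)
    have hq := (T.mem_of_mem hB h1).1 hp
    have hr := (T.mem_of_mem hB h2).1 hp
    exact (T.oriented B hB).out (p := p) (by simp [*]) (by simp [*])
  into p q r h1 h2 := by
    obtain ⟨B, hB, hp⟩ := T.partition.exists_mem (Finset.mem_univ p)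
    have hq := (T.mem_of_mem hB h1).2 hp
    have hr := (T.mem_of_mem hB h2).2 hp
    exact (T.oriented B hB).into (p := p) (by simp [*]) (by simp [*])
  triangle p q r h1 h2 := by
    obtain ⟨B, hB, hp⟩ := T.partition.exists_mem (Finset.mem_univ p)
    have hq := (T.mem_of_mem hB h1).1 hp
    have hr := (T.mem_of_mem hB h2).1 hq
    have := (T.oriented B hB).triangle (p := p) (q := q) (r := r) (by simp [*]) (by simp [*])
    exact (Finset.mem_inter.1 this).1
  adjacent p := by
    obtain ⟨B, hB, hp⟩ := T.partition.exists_mem (Finset.mem_univ p)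
    obtain ⟨q, hq⟩ := (T.oriented B hB).adjacent hp
    exact ⟨q, hq.imp (fun h => (Finset.mem_inter.1 h).1) fun h => (Finset.mem_inter.1 h).1⟩

/-- A block consists of any one of its elements together with the neighbors of that element. The
right-hand side involves only the edges, whence injectivity of `tau3Equiv`. -/
theorem Tau3Structure.mem_parts_iff (T : Tau3Structure V) (B : Finset V) :
    B ∈ T.partition.parts ↔ ∃ p, ∀ q, q ∈ B ↔ q = p ∨ (p, q) ∈ T.edges ∨ (q, p) ∈ T.edges := by
  have key : ∀ B ∈ T.partition.parts, ∀ p ∈ B, ∀ q,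
      q ∈ B ↔ q = p ∨ (p, q) ∈ T.edges ∨ (q, p) ∈ T.edges := by
    intro B hB p hp q
    constructor
    · intro hq
      by_cases h : q = p
      · exact Or.inl h
      · right
        exact ((T.oriented B hB).mem_or_mem hp hq (Ne.symm h)).imp
          (fun h => (Finset.mem_inter.1 h).1) fun h => (Finset.mem_inter.1 h).1
    · rintro (rfl | h | h)
      · exact hp
      · exact (T.mem_of_mem hB h).1 hp
      · exact (T.mem_of_mem hB h).2 hp
  constructor
  · intro hB
    obtain ⟨p, hp⟩ := T.partition.nonempty_of_mem_parts hB
    exact ⟨p, key B hB p hp⟩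
  · rintro ⟨p, hp⟩
    obtain ⟨B', hB', hp'⟩ := T.partition.exists_mem (Finset.mem_univ p)
    have : B = B' := Finset.ext fun q => (hp q).trans (key B' hB' p hp' q).symm
    rwa [this]

/-- The vertices which are adjacent to a vertex, including itself. -/
def block (R : V → V → Prop) (p : V) : Finset V :=
  open Classical in Finset.univ.filter fun q => q = p ∨ R p q ∨ R q p

@[simp]
theorem mem_block {R : V → V → Prop} {p q : V} : q ∈ block R p ↔ q = p ∨ R p q ∨ R q p := by
  simp [block]

/-- A loop at `p` excludes every other edge at `p`. Without a loop, two consecutive edges close up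
to a triangle of distinct vertices, and by uniqueness of outgoing and incoming edges nothing else is
attached. Otherwise the block is a single edge, of which `p` is the source or the target. -/
theorem IsTau3Relation.isOrientation_block {R : V → V → Prop} (hR : IsTau3Relation V R) (p : V) :
    IsOrientation (block R p) (edgeSet R ∩ block R p ×ˢ block R p) := by
  have ho := hR.out
  have hi := hR.into
  have ht := hR.triangle
  by_cases hpp : R p p
  · refine Or.inl ⟨p, ?_, ?_⟩
    · ext q; simp; grind
    · ext ⟨x, y⟩; simp; grind
  by_cases h1 : ∃ q, R p q
  · obtain ⟨q, hq⟩ := h1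
    by_cases h2 : ∃ r, R q r
    · obtain ⟨r, hr⟩ := h2
      have hrp := ht _ _ _ hq hr
      refine Or.inr (Or.inr ⟨p, q, r, ?_, ?_, ?_, ?_, ?_⟩)
      · grind
      · grind
      · grind
      · ext x; simp; grind
      · ext ⟨x, y⟩; simp; grind
    · refine Or.inr (Or.inl ⟨p, q, ?_, ?_, ?_⟩)
      · grind
      · ext x; simp; grind
      · ext ⟨x, y⟩; simp; grind
  -- No edge leaves `p`, so the edge at `p` comes from `q`.
  · obtain ⟨q, hq⟩ := hR.adjacent p
    refine Or.inr (Or.inl ⟨q, p, ?_, ?_, ?_⟩)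
    · grind
    · ext x; simp; grind
    · ext ⟨x, y⟩; simp; grind

/-- The triangle condition, with uniqueness of outgoing and incoming edges, makes adjacency
transitive, so the blocks partition the vertices. -/
theorem IsTau3Relation.block_eq {R : V → V → Prop} (hR : IsTau3Relation V R) {p q : V}
    (h : q ∈ block R p) : block R q = block R p := by
  have ho := hR.out
  have hi := hR.into
  have ht := hR.triangle
  ext x
  simp at h ⊢
  grind

theorem exists_tau3Structure {R : V → V → Prop} (hR : IsTau3Relation V R) :
    ∃ T : Tau3Structure V, (fun p q => (p, q) ∈ T.edges) = R := by
  refine ⟨⟨Finpartition.ofExistsUnique (Finset.univ.image (block R)) ?_ ?_ ?_, edgeSet R, ?_, ?_⟩,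
    ?_⟩
  · simp
  · intro p _
    refine ⟨block R p, ⟨by simp, by simp⟩, ?_⟩
    rintro B ⟨hB, hp⟩
    obtain ⟨q, -, rfl⟩ := Finset.mem_image.1 hB
    exact (hR.block_eq hp).symm
  · intro h
    obtain ⟨q, -, hq⟩ := Finset.mem_image.1 h
    have : q ∈ block R q := by simp
    simp [hq] at this
  · rintro ⟨p, q⟩ h
    exact ⟨block R p, Finset.mem_image_of_mem _ (Finset.mem_univ _), by simp,
      by simpa using Or.inr (Or.inl h)⟩
  · intro B hB
    obtain ⟨q, -, rfl⟩ := Finset.mem_image.1 hB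
    exact hR.isOrientation_block q
  · ext p q
    simp

/-- `τ₃`-structures correspond to their relations. -/
def tau3Equiv (V : Type) [Fintype V] [DecidableEq V] :
    Tau3Structure V ≃ {R : V → V → Prop // IsTau3Relation V R} :=
  Equiv.ofBijective (fun T => ⟨_, T.isTau3Relation⟩) ⟨by
    intro S T h
    have h' := fun p q => iff_of_eq (congrFun (congrFun (congrArg Subtype.val h) p) q)
    refine Tau3Structure.ext (Finpartition.ext (Finset.ext fun B => ?_))
      (Finset.ext fun x => h' x.1 x.2)
    rw [S.mem_parts_iff, T.mem_parts_iff]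
    exact exists_congr fun p => forall_congr' fun q =>
      iff_congr Iff.rfl (or_congr Iff.rfl (or_congr (h' p q) (h' q p))), by
    rintro ⟨R, hR⟩
    obtain ⟨S, hS⟩ := exists_tau3Structure hR
    exact ⟨S, Subtype.ext hS⟩⟩

/-- Pairs of structures correspond to the graphs which they determine. -/
def graphOfEquiv (V : Type) [Fintype V] [DecidableEq V] :
    Tau2Structure V × Tau3Structure V ≃
      {Γ : LabeledGraph V // Γ.HasProps IsTau2Relation IsTau3Relation} :=
  ((tau2Equiv V).prodCongr (tau3Equiv V)).trans (hasPropsEquiv _ _ V).symm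

theorem graphOfEquiv_coe (x : Tau2Structure V × Tau3Structure V) :
    (graphOfEquiv V x : LabeledGraph V) = graphOf x.1 x.2 := rfl

theorem graphOf_hasProps (S : Tau2Structure V) (T : Tau3Structure V) :
    (graphOf S T).HasProps IsTau2Relation IsTau3Relation :=
  ⟨S.isTau2Relation, T.isTau3Relation⟩

theorem isDetermined_iff (Γ : LabeledGraph V) :
    Γ.IsDetermined ↔ Nonempty V ∧ Γ.HasProps IsTau2Relation IsTau3Relation := by
  refine and_congr_right fun _ => ⟨?_, fun h => ?_⟩
  · rintro ⟨S, T, rfl⟩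
    exact graphOf_hasProps S T
  · refine ⟨((graphOfEquiv V).symm ⟨Γ, h⟩).1, ((graphOfEquiv V).symm ⟨Γ, h⟩).2, ?_⟩
    rw [← graphOfEquiv_coe, Equiv.apply_symm_apply]


/-! ### Connected graphs with edges of a single label -/

section ConnCount

variable {V : Type} [Fintype V] [DecidableEq V]

/-- The ends of an `a`-edge are closed under adjacency, so they are all the vertices. The edges are
thereby forced, and at most one such graph exists. -/
theorem aEdge_iff_of_isConnected {Γ : LabeledGraph V}
    (h : Γ.HasProps IsTau2Relation IsEmptyRelation) (hc : Γ.IsConnected) (p q : V) :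
    Γ.aEdge p q ↔ ({p, q} : Finset V) = Finset.univ := by
  have key : ∀ p q, Γ.aEdge p q → ({p, q} : Finset V) = Finset.univ := by
    intro p q hpq
    refine Finset.eq_univ_of_forall fun x => ?_
    refine mem_of_reachable (s := fun x => x ∈ ({p, q} : Finset V)) ?_ (hc.preconnected p x)
      (by simp)
    intro y z hyz hy
    have hyz' : Γ.aEdge y z := by
      rcases (underlying_adj.1 hyz).2 with (h' | h') | h' | h'
      · exact h'
      · exact absurd h' (h.2 _ _)
      · exact h.1.symm _ _ h'
      · exact absurd h' (h.2 _ _)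
    have hqp := h.1.symm _ _ hpq
    have ho := h.1.out
    simp only [Finset.mem_insert, Finset.mem_singleton] at hy ⊢
    grind
  refine ⟨key p q, fun hpq => ?_⟩
  obtain ⟨x, hx⟩ := h.1.adjacent p
  have hx' : x ∈ ({p, q} : Finset V) := hpq ▸ Finset.mem_univ x
  have hq : q ∈ ({p, x} : Finset V) := key p x hx ▸ Finset.mem_univ q
  simp only [Finset.mem_insert, Finset.mem_singleton] at hx' hq
  grind

theorem connCount_tau2_of_card_le (hV : 0 < Fintype.card V) (hV' : Fintype.card V ≤ 2) :
    connCount IsTau2Relation IsEmptyRelation V = 1 := by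
  rw [connCount, Nat.card_eq_one_iff_exists]
  have hne : Nonempty V := Fintype.card_pos_iff.1 hV
  have hpair : ∀ p : V, ∃ q, ({p, q} : Finset V) = Finset.univ := by
    intro p
    obtain h1 | h2 : Fintype.card V = 1 ∨ Fintype.card V = 2 := by omega
    · obtain ⟨x, hx⟩ := Finset.card_eq_one.1 (Finset.card_univ.trans h1)
      obtain rfl : p = x := by simpa [hx] using Finset.mem_univ p
      exact ⟨p, by simp [hx]⟩
    · obtain ⟨x, y, -, hxy⟩ := Finset.card_eq_two.1 (Finset.card_univ.trans h2)
      obtain rfl | rfl : p = x ∨ p = y := by simpa [hxy] using Finset.mem_univ p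
      · exact ⟨y, hxy.symm⟩
      · exact ⟨x, by rw [hxy, Finset.pair_comm]⟩
  refine ⟨⟨⟨fun p q => ({p, q} : Finset V) = Finset.univ, fun _ _ => False⟩,
    ⟨⟨fun p q r h1 h2 => ?_, fun p q h => ?_, hpair⟩, fun _ _ h => h⟩, ⟨fun p q => ?_⟩⟩, ?_⟩
  · have hq : q ∈ ({p, r} : Finset V) := h2 ▸ Finset.mem_univ q
    have hr : r ∈ ({p, q} : Finset V) := h1 ▸ Finset.mem_univ r
    simp only [Finset.mem_insert, Finset.mem_singleton] at hq hr
    grind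
  · exact (Finset.pair_comm q p).trans h
  · by_cases hpq : p = q
    · rw [hpq]
    · refine reachable_of_edge (Or.inl (Or.inl (?_ : ({p, q} : Finset V) = Finset.univ)))
      obtain ⟨x, hx⟩ := hpair p
      have hq : q ∈ ({p, x} : Finset V) := hx ▸ Finset.mem_univ q
      simp only [Finset.mem_insert, Finset.mem_singleton] at hq
      grind
  · rintro ⟨Γ, h, hc⟩
    refine Subtype.ext (LabeledGraph.ext ?_ ?_)
    · ext p q
      exact aEdge_iff_of_isConnected h hc p q
    · ext p q
      simpa using h.2 p q

theorem connCount_tau2_of_two_lt (hV : 2 < Fintype.card V) :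
    connCount IsTau2Relation IsEmptyRelation V = 0 := by
  rw [connCount, Nat.card_eq_zero]
  refine Or.inl ⟨fun ⟨Γ, h, hc⟩ => ?_⟩
  obtain ⟨p⟩ : Nonempty V := Fintype.card_pos_iff.1 (by omega)
  obtain ⟨q, hq⟩ := h.1.adjacent p
  have := (aEdge_iff_of_isConnected h hc p q).1 hq
  rw [← Finset.card_univ, ← this] at hV
  exact absurd Finset.card_le_two (not_le.2 hV)

theorem isOrientation_univ_of_isConnected {Γ : LabeledGraph V}
    (h : Γ.HasProps IsEmptyRelation IsTau3Relation) (hc : Γ.IsConnected) :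
    IsOrientation Finset.univ (edgeSet Γ.bEdge) := by
  obtain ⟨p⟩ := hc.nonempty
  have hp : block Γ.bEdge p = Finset.univ := by
    refine Finset.eq_univ_of_forall fun x => ?_
    refine mem_of_reachable (s := fun x => x ∈ block Γ.bEdge p) ?_ (hc.preconnected p x) (by simp)
    intro y z hyz hy
    rw [← h.2.block_eq hy, mem_block]
    rcases (underlying_adj.1 hyz).2 with (h' | h') | h' | h'
    · exact absurd h' (h.1 _ _)
    · exact Or.inr (Or.inl h')
    · exact absurd h' (h.1 _ _)
    · exact Or.inr (Or.inr h')
  simpa [hp] using h.2.isOrientation_block p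

theorem IsOrientation.isTau3Relation {E : Finset (V × V)} (h : IsOrientation Finset.univ E) :
    IsTau3Relation V fun p q => (p, q) ∈ E where
  out _ _ _ := h.out
  into _ _ _ := h.into
  triangle _ _ _ := h.triangle
  adjacent p := h.adjacent (Finset.mem_univ p)

/-- Connected graphs with `b`-edges only are orientations of the vertex set. -/
def connectedTau3Equiv (hV : Nonempty V) :
    {Γ : LabeledGraph V // Γ.HasProps IsEmptyRelation IsTau3Relation ∧ Γ.IsConnected} ≃
      {E : Finset (V × V) // IsOrientation Finset.univ E} where
  toFun Γ := ⟨edgeSet Γ.1.bEdge, isOrientation_univ_of_isConnected Γ.2.1 Γ.2.2⟩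
  invFun E := ⟨⟨fun _ _ => False, fun p q => (p, q) ∈ E.1⟩, ⟨fun _ _ h => h, E.2.isTau3Relation⟩, by
    refine ⟨fun p q => ?_⟩
    by_cases hpq : p = q
    · rw [hpq]
    · refine reachable_of_edge ?_
      simpa using E.2.mem_or_mem (Finset.mem_univ p) (Finset.mem_univ q) hpq⟩
  left_inv := by
    rintro ⟨Γ, h, hc⟩
    refine Subtype.ext (LabeledGraph.ext ?_ ?_)
    · ext p q
      simpa using h.1 p q
    · ext p q
      simp
  right_inv := by
    rintro ⟨E, hE⟩
    refine Subtype.ext ?_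
    ext x
    simp

theorem connCount_tau3 (hV : Nonempty V) :
    connCount IsEmptyRelation IsTau3Relation V =
      Nat.card {E : Finset (V × V) // IsOrientation Finset.univ E} :=
  Nat.card_congr (connectedTau3Equiv hV)

theorem connCount_tau3_of_three_lt (hV : 3 < Fintype.card V) :
    connCount IsEmptyRelation IsTau3Relation V = 0 := by
  have hne : Nonempty V := Fintype.card_pos_iff.1 (by omega)
  rw [connCount_tau3 hne, Nat.card_eq_zero]
  refine Or.inl ⟨fun ⟨E, hE⟩ => ?_⟩
  rw [← Finset.card_univ] at hV
  rcases hE with ⟨p, h, -⟩ | ⟨p, q, -, h, -⟩ | ⟨p, q, r, -, -, -, h, -⟩ <;> rw [h] at hV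
  · simp at hV
  · exact absurd (Finset.card_le_two (a := p) (b := q)) (by omega)
  · exact absurd (Finset.card_le_three (a := p) (b := q) (c := r)) (by omega)

end ConnCount

theorem connCount_tau3_one : connCount IsEmptyRelation IsTau3Relation (Fin 1) = 1 := by
  rw [connCount_tau3 ⟨0⟩, Nat.card_eq_one_iff_exists]
  refine ⟨⟨{(0, 0)}, Or.inl ⟨0, by decide, rfl⟩⟩, ?_⟩
  rintro ⟨E, ⟨p, -, rfl⟩ | ⟨p, q, h, -⟩ | ⟨p, q, r, h, -⟩⟩
  · obtain rfl := Subsingleton.elim p 0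
    rfl
  · exact absurd (Subsingleton.elim p q) h
  · exact absurd (Subsingleton.elim p q) h

theorem connCount_tau3_two : connCount IsEmptyRelation IsTau3Relation (Fin 2) = 2 := by
  rw [connCount_tau3 ⟨0⟩, ← Set.coe_ofPred, Nat.card_coe_set_eq]
  refine (congrArg Set.ncard (Set.ext fun E => ⟨?_, ?_⟩)).trans
    (Set.ncard_pair (a := ({(0, 1)} : Finset (Fin 2 × Fin 2))) (b := {(1, 0)}) (by decide))
  · rintro (⟨p, h, -⟩ | ⟨p, q, h, -, rfl⟩ | ⟨p, q, r, h1, h2, h3, -⟩)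
    · exfalso; clear * - h; revert p; decide
    · revert p q; decide
    · exfalso; clear * - h1 h2 h3; revert p q r; decide
  · rintro (rfl | rfl)
    · exact Or.inr (Or.inl ⟨0, 1, by decide, by decide, rfl⟩)
    · exact Or.inr (Or.inl ⟨1, 0, by decide, by decide, rfl⟩)

theorem connCount_tau3_three : connCount IsEmptyRelation IsTau3Relation (Fin 3) = 2 := by
  rw [connCount_tau3 ⟨0⟩, ← Set.coe_ofPred, Nat.card_coe_set_eq]
  refine (congrArg Set.ncard (Set.ext fun E => ⟨?_, ?_⟩)).trans
    (Set.ncard_pair (a := ({(0, 1), (1, 2), (2, 0)} : Finset (Fin 3 × Fin 3)))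
      (b := {(1, 0), (0, 2), (2, 1)}) (by decide))
  · rintro (⟨p, h, -⟩ | ⟨p, q, h, h', -⟩ | ⟨p, q, r, h1, h2, h3, -, rfl⟩)
    · exfalso; clear * - h; revert p; decide
    · exfalso; clear * - h'; revert p q; decide
    · revert p q r; decide
  · rintro (rfl | rfl)
    · exact Or.inr (Or.inr ⟨0, 1, 2, by decide, by decide, by decide, by decide, rfl⟩)
    · exact Or.inr (Or.inr ⟨1, 0, 2, by decide, by decide, by decide, by decide, rfl⟩)

/-! ### Recurrences for the counts, and the generating series -/

/-- The number of `τ₂`-structures. -/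
def tau2Count (n : ℕ) : ℕ := Nat.card (Tau2Structure (Fin n))

/-- The number of `τ₃`-structures. -/
def tau3Count (n : ℕ) : ℕ := Nat.card (Tau3Structure (Fin n))

/-- The number of proper `PSL₂(ℤ)`-cyclically reduced graphs. -/
def properCount (n : ℕ) : ℕ :=
  Nat.card {Γ : LabeledGraph (Fin n) // Γ.IsProperCyclicallyReduced}

theorem card_isEmptyRelation (V : Type) :
    Nat.card {R : V → V → Prop // IsEmptyRelation V R} = 1 := by
  rw [Nat.card_eq_one_iff_exists]
  refine ⟨⟨fun _ _ => False, fun _ _ h => h⟩, fun R => Subtype.ext ?_⟩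
  ext p q
  simpa using R.2 p q

theorem count_tau2 (n : ℕ) : count IsTau2Relation IsEmptyRelation (Fin n) = tau2Count n := by
  rw [count, Nat.card_congr (hasPropsEquiv _ _ _), Nat.card_prod, card_isEmptyRelation, mul_one,
    tau2Count, Nat.card_congr (tau2Equiv (Fin n))]

theorem count_tau3 (n : ℕ) : count IsEmptyRelation IsTau3Relation (Fin n) = tau3Count n := by
  rw [count, Nat.card_congr (hasPropsEquiv _ _ _), Nat.card_prod, card_isEmptyRelation, one_mul,
    tau3Count, Nat.card_congr (tau3Equiv (Fin n))]

theorem count_tau2_tau3 (n : ℕ) :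
    count IsTau2Relation IsTau3Relation (Fin n) = tau2Count n * tau3Count n := by
  rw [count, ← Nat.card_congr (graphOfEquiv (Fin n)), Nat.card_prod, tau2Count, tau3Count]

theorem connCount_eq_properCount (n : ℕ) :
    connCount IsTau2Relation IsTau3Relation (Fin n) = properCount n :=
  Nat.card_congr (Equiv.subtypeEquivRight fun Γ => (isProperCyclicallyReduced_iff Γ).symm)

theorem tau2Count_zero : tau2Count 0 = 1 := by
  rw [← count_tau2, count, Nat.card_eq_one_iff_exists]
  refine ⟨⟨⟨fun _ _ => False, fun _ _ => False⟩, ⟨by simp, by simp, by simp⟩,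
    by simp [IsEmptyRelation]⟩, ?_⟩
  rintro ⟨Γ, h⟩
  refine Subtype.ext (LabeledGraph.ext ?_ ?_) <;> exact funext finZeroElim

theorem tau3Count_zero : tau3Count 0 = 1 := by
  rw [← count_tau3, count, Nat.card_eq_one_iff_exists]
  refine ⟨⟨⟨fun _ _ => False, fun _ _ => False⟩, by simp [IsEmptyRelation],
    ⟨by simp, by simp, by simp, by simp⟩⟩, ?_⟩
  rintro ⟨Γ, h⟩
  refine Subtype.ext (LabeledGraph.ext ?_ ?_) <;> exact funext finZeroElim

theorem connCount_tau2_fin_one : connCount IsTau2Relation IsEmptyRelation (Fin 1) = 1 :=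
  connCount_tau2_of_card_le (by simp) (by simp)

theorem tau2Count_one : tau2Count 1 = 1 := by
  rw [← count_tau2, count_fin_succ isLocal_isTau2Relation isLocal_isEmptyRelation 0]
  simp [connCount_tau2_fin_one, count_tau2, tau2Count_zero]

theorem tau2Count_add_two (n : ℕ) :
    tau2Count (n + 2) = tau2Count (n + 1) + (n + 1) * tau2Count n := by
  rw [← count_tau2, count_fin_succ isLocal_isTau2Relation isLocal_isEmptyRelation (n + 1),
    ← Finset.sum_subset (Finset.range_subset_range.2 (by omega : 2 ≤ n + 1 + 1))]
  · simp [Finset.sum_range_succ, connCount_tau2_fin_one, count_tau2,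
      connCount_tau2_of_card_le (V := Fin 2) (by simp) (by simp)]
  · intro k _ hk
    rw [Finset.mem_range] at hk
    rw [connCount_tau2_of_two_lt (by simp; omega)]
    simp

/-- The truncated subtractions are harmless: the factors `n` and `n.choose 2` vanish whenever
truncation occurs. -/
theorem count_tau3_succ (n : ℕ) :
    tau3Count (n + 1) = tau3Count n + n * (2 * tau3Count (n - 1)) +
      n.choose 2 * (2 * tau3Count (n - 2)) := by
  have h : tau3Count (n + 1) = ∑ k ∈ Finset.range 3, n.choose k *
      (connCount IsEmptyRelation IsTau3Relation (Fin (k + 1)) * tau3Count (n - k)) := by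
    rw [← count_tau3, count_fin_succ isLocal_isEmptyRelation isLocal_isTau3Relation n]
    simp only [count_tau3]
    -- Both sums are extended to `range (n + 3)`: on one side the connected counts vanish for `k ≥
    -- 3`, on the other the binomial coefficients vanish for `k > n`.
    rw [Finset.sum_subset (Finset.range_subset_range.2 (by omega : 3 ≤ n + 3)),
      Finset.sum_subset (Finset.range_subset_range.2 (by omega : n + 1 ≤ n + 3))]
    · intro k _ hk
      rw [Finset.mem_range] at hk
      rw [Nat.choose_eq_zero_of_lt (by omega), zero_mul]
    · intro k _ hk
      rw [Finset.mem_range] at hk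
      rw [connCount_tau3_of_three_lt (by simp; omega)]
      simp
  rw [h]
  simp [Finset.sum_range_succ, connCount_tau3_one, connCount_tau3_two, connCount_tau3_three]

theorem tau3Count_one : tau3Count 1 = 1 := by
  simp [count_tau3_succ 0, tau3Count_zero]

theorem tau3Count_two : tau3Count 2 = 3 := by
  simp [count_tau3_succ 1, tau3Count_zero, tau3Count_one]

theorem tau3Count_add_three (n : ℕ) :
    tau3Count (n + 3) = tau3Count (n + 2) + 2 * (n + 2) * tau3Count (n + 1) +
      (n + 2) * (n + 1) * tau3Count n := by
  have h : (n + 2).choose 2 * 2 = (n + 2) * (n + 1) := by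
    have := Nat.triangle_succ (n + 1)
    rw [Nat.choose_two_right, Nat.div_mul_cancel]
    · simp
    · simpa using (Nat.even_mul_pred_self (n + 2)).two_dvd
  rw [count_tau3_succ (n + 2), ← h]
  simp only [Nat.add_sub_cancel, show n + 2 - 1 = n + 1 from rfl]
  ring

/-- The decomposition of a graph into the component of a vertex and the other components. -/
theorem tau2Count_mul_tau3Count_succ (n : ℕ) :
    tau2Count (n + 1) * tau3Count (n + 1) = ∑ k ∈ Finset.range (n + 1),
      n.choose k * (properCount (k + 1) * (tau2Count (n - k) * tau3Count (n - k))) := by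
  rw [← count_tau2_tau3, count_fin_succ isLocal_isTau2Relation isLocal_isTau3Relation]
  simp only [count_tau2_tau3, connCount_eq_properCount]

theorem properCount_le (n : ℕ) : properCount n ≤ tau2Count n * tau3Count n := by
  rw [← connCount_eq_properCount, ← count_tau2_tau3]
  exact Nat.card_mono (Set.toFinite {Γ : LabeledGraph (Fin n) | Γ.HasProps _ _}) fun _ h => h.1

/-- By `graphOfEquiv`, distinct pairs of structures determine distinct graphs, so counting pairs is
counting graphs. -/
theorem prob_eq (n : ℕ) : prob n = properCount n / (tau2Count n * tau3Count n : ℕ) := by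
  rw [prob, Nat.card_prod, tau2Count, tau3Count, properCount]
  congr 2
  refine Nat.card_congr (((graphOfEquiv (Fin n)).subtypeEquiv fun x => Iff.rfl).trans
    ((Equiv.subtypeSubtypeEquivSubtypeInter _
      fun Γ : LabeledGraph (Fin n) => Γ.IsProperCyclicallyReduced).trans
      (Equiv.subtypeEquivRight fun Γ => and_iff_right_of_imp fun h =>
        ((isProperCyclicallyReduced_iff Γ).1 h).1)))

/-- There are at most `n` loops of each label, so the cutoff at `2 * n` loops loses no graph. -/
theorem coeff_atOne_egs (C : (n : ℕ) → LabeledGraph (Fin n) → Prop) (n : ℕ) :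
    PowerSeries.coeff n (atOne (egs C)) =
      (Nat.card {Γ : LabeledGraph (Fin n) // C n Γ} : ℝ) / n.factorial := by
  rw [atOne, egs, PowerSeries.coeff_map, PowerSeries.coeff_mk, map_sum]
  simp only [Polynomial.coe_evalRingHom, Polynomial.eval_monomial, one_pow, mul_one]
  rw [← Finset.sum_div, ← Nat.cast_sum]
  congr 2
  have hle : ∀ Γ : LabeledGraph (Fin n), Γ.numLoops < 2 * n + 1 := by
    intro Γ
    have h1 := Finite.card_subtype_le fun p => Γ.aEdge p p
    have h2 := Finite.card_subtype_le fun p => Γ.bEdge p p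
    rw [Nat.card_fin] at h1 h2
    unfold LabeledGraph.numLoops
    omega
  let f : {Γ : LabeledGraph (Fin n) // C n Γ} → Fin (2 * n + 1) := fun Γ =>
    ⟨Γ.1.numLoops, hle Γ.1⟩
  rw [← Nat.card_congr (Equiv.sigmaFiberEquiv f), Nat.card_sigma, Finset.sum_range]
  refine Finset.sum_congr rfl fun l _ => Nat.card_congr ?_
  refine ((Equiv.subtypeSubtypeEquivSubtypeInter (C n) fun Γ => Γ.numLoops = l).symm).trans
    (Equiv.subtypeEquivRight fun Γ => ?_)
  simp [f, Fin.ext_iff]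

theorem coeff_atOne_Gpr (n : ℕ) :
    PowerSeries.coeff n (atOne Gpr) = (properCount n : ℝ) / n.factorial :=
  coeff_atOne_egs _ n

theorem coeff_atOne_GprTilde {n : ℕ} (hn : 1 ≤ n) :
    PowerSeries.coeff n (atOne GprTilde) =
      ((tau2Count n * tau3Count n : ℕ) : ℝ) / n.factorial := by
  rw [GprTilde, coeff_atOne_egs, ← count_tau2_tau3, count]
  congr 2
  refine Nat.card_congr (Equiv.subtypeEquivRight fun Γ => ?_)
  rw [isDetermined_iff]
  exact and_iff_right ⟨⟨0, hn⟩⟩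

theorem tau2Count_pos (n : ℕ) : 0 < tau2Count n := by
  induction n using Nat.twoStepInduction with
  | zero => simp [tau2Count_zero]
  | one => simp [tau2Count_one]
  | more n _ h => rw [tau2Count_add_two]; omega

theorem tau3Count_pos (n : ℕ) : 0 < tau3Count n := by
  induction n with
  | zero => simp [tau3Count_zero]
  | succ n h => rw [count_tau3_succ]; omega

/-! ### Quotients of successive terms of the counting sequences -/

/-- Bounds for the quotients of the numbers of involutions. -/
theorem sqrt_mul_le_of_recurrence {t : ℕ → ℝ} (h0 : t 0 = 1) (h1 : t 1 = 1)
    (hpos : ∀ n, 0 < t n) (h : ∀ n, t (n + 2) = t (n + 1) + (n + 1) * t n) (n : ℕ) :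
    √(n + 1) * t n ≤ t (n + 1) ∧ t (n + 1) ≤ (√(n + 1) + 1) * t n := by
  induction n with
  | zero => norm_num [h0, h1]
  | succ n ih =>
    obtain ⟨ihl, ihu⟩ := ih
    have hx0 : (0 : ℝ) ≤ n + 1 := by positivity
    have hx : √((n : ℝ) + 1) ^ 2 = n + 1 := Real.sq_sqrt hx0
    have hxpos : 0 < √((n : ℝ) + 1) := Real.sqrt_pos.2 (by positivity)
    have hz : √((n : ℝ) + 1 + 1) ^ 2 = n + 1 + 1 := Real.sq_sqrt (by positivity)
    have hxz : √((n : ℝ) + 1) ≤ √((n : ℝ) + 1 + 1) := Real.sqrt_le_sqrt (by linarith)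
    rw [h n]
    push_cast
    set x := √((n : ℝ) + 1)
    set z := √((n : ℝ) + 1 + 1)
    have ht := hpos n
    have ht1 := hpos (n + 1)
    rw [← hx] at hz ⊢
    constructor
    -- With $r_n=t_{n+1}/t_n$ one has $r_{n+1}=1+x^2/r_n$, and $r_n\le x+1$ gives
    -- $r_{n+1}\ge(x^2+x+1)/(x+1)$. Here $(x^2+x+1)^2$ exceeds $(x^2+1)(x+1)^2$ by exactly $x^2$.
    · have hzx : z * (x + 1) ≤ x ^ 2 + x + 1 := by
        refine (sq_le_sq₀ (by positivity) (by positivity)).1 ?_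
        rw [mul_pow, hz]
        nlinarith
      have h3 : z * (x + 1) * t (n + 1) ≤ (x ^ 2 + x + 1) * t (n + 1) := by gcongr
      have h4 : x ^ 2 * t (n + 1) ≤ x ^ 2 * ((x + 1) * t n) := by gcongr
      have : (x + 1) * (z * t (n + 1)) ≤ (x + 1) * (t (n + 1) + x ^ 2 * t n) := by nlinarith
      exact le_of_mul_le_mul_left this (by positivity)
    · have : x * (x * t n) ≤ x * t (n + 1) := by gcongr
      nlinarith

/-- The coefficients of `exp (z ^ 2 + z ^ 3 / 3)`. -/
def fixedPointFreeCoeff : ℕ → ℝ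
  | 0 => 1
  | 1 => 0
  | 2 => 1
  | n + 3 => (2 * fixedPointFreeCoeff (n + 1) + fixedPointFreeCoeff n) / (n + 3)

theorem fixedPointFreeCoeff_nonneg (n : ℕ) : 0 ≤ fixedPointFreeCoeff n := by
  induction n using Nat.strong_induction_on with
  | _ n ih =>
    match n with
    | 0 => simp [fixedPointFreeCoeff]
    | 1 => simp [fixedPointFreeCoeff]
    | 2 => simp [fixedPointFreeCoeff]
    | n + 3 =>
      rw [fixedPointFreeCoeff]
      have h1 := ih (n + 1) (by omega)
      have h2 := ih n (by omega)
      positivity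

open PowerSeries in
/-- The power series `exp (z + z ^ 2 + z ^ 3 / 3)`. -/
def tau3Series : PowerSeries ℝ := PowerSeries.exp ℝ * PowerSeries.mk fixedPointFreeCoeff

open PowerSeries in
theorem derivative_tau3Series :
    PowerSeries.derivative ℝ tau3Series = tau3Series + 2 * X * tau3Series + X ^ 2 * tau3Series := by
  have hD : PowerSeries.derivative ℝ (PowerSeries.mk fixedPointFreeCoeff) =
      2 * (X * PowerSeries.mk fixedPointFreeCoeff) +
        X ^ 2 * PowerSeries.mk fixedPointFreeCoeff := by
    ext n
    have h2 : (2 : PowerSeries ℝ) = C 2 := (map_ofNat C 2).symm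
    rw [h2, PowerSeries.coeff_derivative, map_add, PowerSeries.coeff_C_mul]
    match n with
    | 0 => simp [fixedPointFreeCoeff, PowerSeries.coeff_X_pow_mul']
    | 1 => simp [fixedPointFreeCoeff, PowerSeries.coeff_X_pow_mul',
        PowerSeries.coeff_succ_X_mul]; norm_num
    | n + 2 =>
      rw [PowerSeries.coeff_succ_X_mul, PowerSeries.coeff_X_pow_mul]
      simp only [PowerSeries.coeff_mk, fixedPointFreeCoeff]
      have : (n : ℝ) + 3 ≠ 0 := by positivity
      push_cast
      field_simp
      ring
  rw [tau3Series, Derivation.leibniz, hD, PowerSeries.derivative_exp]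
  simp only [smul_eq_mul]
  ring

theorem coeff_tau3Series_zero : PowerSeries.coeff 0 tau3Series = 1 := by
  simp [tau3Series, fixedPointFreeCoeff, PowerSeries.coeff_mul]

theorem coeff_tau3Series_one : PowerSeries.coeff 1 tau3Series = 1 := by
  simp [tau3Series, fixedPointFreeCoeff, PowerSeries.coeff_mul,
    Finset.Nat.antidiagonal_succ, PowerSeries.coeff_exp]

theorem succ_mul_coeff_tau3Series (n : ℕ) :
    PowerSeries.coeff (n + 1) tau3Series * (n + 1) = PowerSeries.coeff n (tau3Series +
      2 * PowerSeries.X * tau3Series + PowerSeries.X ^ 2 * tau3Series) := by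
  rw [← derivative_tau3Series, PowerSeries.coeff_derivative]

theorem coeff_tau3Series (n : ℕ) :
    PowerSeries.coeff n tau3Series = (tau3Count n : ℝ) / n.factorial := by
  have h2 : (2 : PowerSeries ℝ) = PowerSeries.C 2 := (map_ofNat PowerSeries.C 2).symm
  induction n using Nat.strong_induction_on with
  | _ n ih =>
    match n with
    | 0 => simp [coeff_tau3Series_zero, tau3Count_zero]
    | 1 => simp [coeff_tau3Series_one, tau3Count_one]
    | 2 =>
      have := succ_mul_coeff_tau3Series 1
      rw [h2, mul_assoc, map_add, map_add, PowerSeries.coeff_C_mul, PowerSeries.coeff_succ_X_mul,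
        PowerSeries.coeff_X_pow_mul', coeff_tau3Series_zero, coeff_tau3Series_one] at this
      norm_num [tau3Count_two] at this ⊢
      linarith
    | n + 3 =>
      have := succ_mul_coeff_tau3Series (n + 2)
      rw [h2, mul_assoc, map_add, map_add, PowerSeries.coeff_C_mul, PowerSeries.coeff_succ_X_mul,
        PowerSeries.coeff_X_pow_mul, ih (n + 2) (by omega), ih (n + 1) (by omega),
        ih n (by omega)] at this
      rw [tau3Count_add_three]
      simp only [Nat.factorial_succ] at this ⊢
      push_cast at this ⊢
      have hf : (n.factorial : ℝ) ≠ 0 := by positivity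
      have h3 : ((n : ℝ) + 2 + 1) ≠ 0 := by positivity
      rw [← eq_div_iff h3] at this
      rw [this]
      field_simp
      ring

/-- The Cauchy–Schwarz inequality for the number of singletons of a random `τ₃`-structure. -/
theorem sq_coeff_tau3Series_le (n : ℕ) :
    PowerSeries.coeff (n + 1) tau3Series ^ 2 ≤ PowerSeries.coeff (n + 2) tau3Series *
      (PowerSeries.coeff n tau3Series + PowerSeries.coeff (n + 1) tau3Series) := by
  have hexp : ∀ i : ℕ, PowerSeries.coeff i (PowerSeries.exp ℝ) = ((i.factorial : ℝ))⁻¹ := by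
    intro i
    simp [PowerSeries.coeff_exp]
  have hX : ∀ i : ℕ, PowerSeries.coeff i (PowerSeries.X * PowerSeries.exp ℝ) =
      i * ((i.factorial : ℝ))⁻¹ := by
    rintro (_ | i)
    · simp
    · rw [PowerSeries.coeff_succ_X_mul, hexp, Nat.factorial_succ]
      push_cast
      field_simp
  have hX2 : ∀ i : ℕ, PowerSeries.coeff i (PowerSeries.X ^ 2 * PowerSeries.exp ℝ +
      PowerSeries.X * PowerSeries.exp ℝ) = (i : ℝ) ^ 2 * ((i.factorial : ℝ))⁻¹ := by
    intro i
    rw [map_add, hX]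
    match i with
    | 0 => simp [PowerSeries.coeff_X_pow_mul']
    | 1 => simp [PowerSeries.coeff_X_pow_mul']
    | i + 2 =>
      rw [PowerSeries.coeff_X_pow_mul, hexp]
      simp only [Nat.factorial_succ]
      push_cast
      field_simp
      ring
  -- The three coefficients become sums over the same antidiagonal, with weights $i$, $i^2$ and $1$
  -- on the nonnegative terms $g_j/i!$, where $g_j$ is `fixedPointFreeCoeff`; $i^2=i(i-1)+i$
  -- accounts for the two series in `h2`.
  have h1 : PowerSeries.coeff (n + 1) tau3Series =
      PowerSeries.coeff (n + 2) (PowerSeries.X * PowerSeries.exp ℝ *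
        PowerSeries.mk fixedPointFreeCoeff) := by
    rw [mul_assoc, PowerSeries.coeff_succ_X_mul, tau3Series]
  have h2 : PowerSeries.coeff n tau3Series + PowerSeries.coeff (n + 1) tau3Series =
      PowerSeries.coeff (n + 2) ((PowerSeries.X ^ 2 * PowerSeries.exp ℝ +
        PowerSeries.X * PowerSeries.exp ℝ) * PowerSeries.mk fixedPointFreeCoeff) := by
    rw [add_mul, mul_assoc, mul_assoc, map_add, PowerSeries.coeff_succ_X_mul,
      PowerSeries.coeff_X_pow_mul, tau3Series]
  rw [h2, h1, tau3Series]
  simp only [PowerSeries.coeff_mul, hexp, hX, hX2, PowerSeries.coeff_mk]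
  refine Finset.sum_sq_le_sum_mul_sum_of_sq_le_mul _ ?_ ?_ ?_
  · intro x _
    have := fixedPointFreeCoeff_nonneg x.2
    positivity
  · intro x _
    have := fixedPointFreeCoeff_nonneg x.2
    positivity
  · intro x _
    exact le_of_eq (by ring)

/-- Bounds for the quotients of a positive sequence with the recurrence relation of the
coefficients of `exp (z + z ^ 2 + z ^ 3 / 3)`; here `x` is the cube root of `n + 1`. -/
theorem quotient_bounds_of_recurrence {u : ℕ → ℝ} (hpos : ∀ n, 0 < u n)
    (hstep : ∀ n, u (n + 1) ≤ u n + 1) (h0 : u 0 ≤ 1) (h1 : u 1 ≤ 1)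
    (h : ∀ n : ℕ, (n : ℝ) + 3 = u (n + 2) * (1 + u (n + 1) * (2 + u n)))
    (n : ℕ) {x : ℝ} (hx0 : 0 ≤ x) (hx : x ^ 3 = n + 1) : x - 4 ≤ u n ∧ u n ≤ x + 1 := by
  -- The hypothesis is an inequality so that the same `x` also serves for smaller indices, as the
  -- lower bound requires.
  have upper : ∀ (n : ℕ) (x : ℝ), 0 ≤ x → n + 1 ≤ x ^ 3 → u n ≤ x + 1 := by
    intro n x hx0 hx
    match n with
    | 0 => linarith
    | 1 => linarith
    | n + 2 =>
      by_contra! hv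
      have hx1 : 1 ≤ x := by
        by_contra! hlt
        have := pow_le_one₀ (n := 3) hx0 hlt.le
        push_cast at hx
        linarith [(n.cast_nonneg : (0 : ℝ) ≤ n)]
      -- Since increments are at most 1, a value above `x + 1` forces the two preceding values to be
      -- at least `x` and `x - 1`; the recurrence then gives $n+3\ge(x+1)(x^2+x+1)>x^3$.
      have e1 := hstep (n + 1)
      have e2 := hstep n
      have g1 : x ≤ u (n + 1) := by linarith
      have g2 : x - 1 ≤ u n := by linarith
      have := h n
      have g3 : x * (2 + (x - 1)) ≤ u (n + 1) * (2 + u n) := by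
        apply mul_le_mul g1 (by linarith) (by linarith) (by linarith)
      have g4 : (x + 1) * (1 + x * (2 + (x - 1))) ≤ u (n + 2) * (1 + u (n + 1) * (2 + u n)) := by
        apply mul_le_mul hv.le (by linarith) (by nlinarith) (by linarith)
      push_cast at hx
      nlinarith
  refine ⟨?_, upper n x hx0 hx.ge⟩
  match n with
  | 0 =>
    have : x ≤ 1 := by
      by_contra! hlt
      have := one_lt_pow₀ hlt (n := 3) (by norm_num)
      norm_num at hx
      linarith
    linarith [hpos 0]
  | 1 =>
    have : x ≤ 2 := by
      by_contra! hlt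
      have : (2 : ℝ) ^ 3 < x ^ 3 := pow_lt_pow_left₀ hlt (by norm_num) (by norm_num)
      norm_num at hx this
      linarith
    linarith [hpos 1]
  | n + 2 =>
    push_cast at hx
    have g1 : u (n + 1) ≤ x + 1 := upper _ x hx0 (by push_cast; linarith)
    have g2 : u n ≤ x + 1 := upper _ x hx0 (by linarith)
    have hp := hpos n
    have hp1 := hpos (n + 1)
    have hp2 := hpos (n + 2)
    have := h n
    -- The upper bounds for the two preceding terms give $x^3\le u_{n+2}(x+2)^2$, and
    -- $(x-4)(x+2)^2=x^3-12x-16$.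
    have g3 : u (n + 2) * (1 + u (n + 1) * (2 + u n)) ≤
        u (n + 2) * (1 + (x + 1) * (2 + (x + 1))) := by gcongr
    have g4 : (x - 4) * (x + 2) ^ 2 ≤ u (n + 2) * (x + 2) ^ 2 := by nlinarith
    exact le_of_mul_le_mul_right g4 (by positivity)

/-- The number of pairs of structures, divided by `n!`. -/
def pairCoeff (n : ℕ) : ℝ := tau2Count n * PowerSeries.coeff n tau3Series

theorem coeff_tau3Series_pos (n : ℕ) : 0 < PowerSeries.coeff n tau3Series := by
  rw [coeff_tau3Series]
  have := tau3Count_pos n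
  positivity

theorem pairCoeff_pos (n : ℕ) : 0 < pairCoeff n :=
  mul_pos (Nat.cast_pos.2 (tau2Count_pos n)) (coeff_tau3Series_pos n)

/-- Quotients of successive terms of `pairCoeff`. -/
theorem abs_pairCoeff_div_sub_le (n : ℕ) {y : ℝ} (hy0 : 0 < y) (hy : y ^ 6 = n + 1) :
    |pairCoeff n / pairCoeff (n + 1) - y⁻¹| ≤ 5 * y⁻¹ ^ 3 := by
  have ht := sqrt_mul_le_of_recurrence (t := fun n => (tau2Count n : ℝ)) (by simp [tau2Count_zero])
    (by simp [tau2Count_one]) (fun n => Nat.cast_pos.2 (tau2Count_pos n))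
    (fun n => by rw [tau2Count_add_two]; push_cast; ring) n
  have hu := quotient_bounds_of_recurrence
    (u := fun n => PowerSeries.coeff n tau3Series / PowerSeries.coeff (n + 1) tau3Series)
    (fun n => div_pos (coeff_tau3Series_pos n) (coeff_tau3Series_pos _)) ?_
    (by simp [coeff_tau3Series_zero, coeff_tau3Series_one])
    (by norm_num [coeff_tau3Series, tau3Count_one, tau3Count_two]) ?_ n (x := y ^ 2) (by positivity)
    (by rw [← hy]; ring)
  · have hs : √((n : ℝ) + 1) = y ^ 3 := by
      rw [← hy, show y ^ 6 = (y ^ 3) ^ 2 by ring]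
      exact Real.sqrt_sq (by positivity)
    rw [hs] at ht
    have hq : pairCoeff n / pairCoeff (n + 1) = (tau2Count n / tau2Count (n + 1) : ℝ) *
        (PowerSeries.coeff n tau3Series / PowerSeries.coeff (n + 1) tau3Series) := by
      rw [pairCoeff, pairCoeff, mul_div_mul_comm]
    have hpos : (0 : ℝ) < tau2Count (n + 1) := Nat.cast_pos.2 (tau2Count_pos _)
    have hpos' : (0 : ℝ) < tau2Count n := Nat.cast_pos.2 (tau2Count_pos _)
    have hupos := div_pos (coeff_tau3Series_pos n) (coeff_tau3Series_pos (n + 1))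
    have ht1 : (tau2Count n / tau2Count (n + 1) : ℝ) ≤ 1 / y ^ 3 := by
      rw [div_le_div_iff₀ hpos (by positivity)]
      linarith [ht.1]
    have ht2 : 1 / (y ^ 3 + 1) ≤ (tau2Count n / tau2Count (n + 1) : ℝ) := by
      rw [div_le_div_iff₀ (by positivity) hpos]
      linarith [ht.2]
    rw [hq]
    set u : ℝ := PowerSeries.coeff n tau3Series / PowerSeries.coeff (n + 1) tau3Series
    set v := (tau2Count n / tau2Count (n + 1) : ℝ)
    have hv : 0 < v := div_pos hpos' hpos
    have hy1 : 1 ≤ y := by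
      by_contra! hlt
      have := pow_lt_one₀ hy0.le hlt (n := 6) (by norm_num)
      linarith [(n.cast_nonneg : (0 : ℝ) ≤ n)]
    rw [abs_le]
    constructor
    · have g1 : 1 / (y ^ 3 + 1) * (y ^ 2 - 4) ≤ v * u := by
        -- Lower bounds can be multiplied only if `y ^ 2 - 4` is nonnegative; otherwise the bound is
        -- trivial.
        by_cases hc : 0 ≤ y ^ 2 - 4
        · exact mul_le_mul ht2 hu.1 hc hv.le
        · refine le_trans ?_ (by positivity : 0 ≤ v * u)
          exact mul_nonpos_of_nonneg_of_nonpos (by positivity) (by linarith)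
      have g2 : y⁻¹ - 5 * y⁻¹ ^ 3 ≤ 1 / (y ^ 3 + 1) * (y ^ 2 - 4) := by
        have : y⁻¹ - 5 * y⁻¹ ^ 3 = (y ^ 2 - 5) / y ^ 3 := by field_simp
        rw [this, one_div_mul_eq_div, div_le_div_iff₀ (by positivity) (by positivity)]
        nlinarith [pow_le_pow_right₀ hy1 (by norm_num : 2 ≤ 3)]
      linarith
    · have g1 : v * u ≤ 1 / y ^ 3 * (y ^ 2 + 1) := mul_le_mul ht1 hu.2 hupos.le (by positivity)
      have g2 : 1 / y ^ 3 * (y ^ 2 + 1) = y⁻¹ + y⁻¹ ^ 3 := by field_simp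
      have : 0 < y⁻¹ ^ 3 := by positivity
      linarith
  · intro n
    have h1 := coeff_tau3Series_pos n
    have h2 := coeff_tau3Series_pos (n + 1)
    have h3 := coeff_tau3Series_pos (n + 2)
    -- Division by $c_{n+1}c_{n+2}$ turns the Cauchy–Schwarz inequality into the bound on the
    -- increments.
    have := sq_coeff_tau3Series_le n
    rw [div_add_one h2.ne', div_le_div_iff₀ h3 h2]
    nlinarith
  · intro n
    have h0 := (coeff_tau3Series_pos n).ne'
    have h1 := (coeff_tau3Series_pos (n + 1)).ne'
    have h2 := (coeff_tau3Series_pos (n + 2)).ne'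
    have h3 := (coeff_tau3Series_pos (n + 3)).ne'
    have h := succ_mul_coeff_tau3Series (n + 2)
    rw [← map_ofNat PowerSeries.C 2, mul_assoc, map_add, map_add,
      PowerSeries.coeff_C_mul, PowerSeries.coeff_succ_X_mul, PowerSeries.coeff_X_pow_mul] at h
    push_cast at h
    simp only [add_assoc, Nat.reduceAdd] at h ⊢
    norm_num at h
    field_simp
    linarith

/-! ### The middle part of the convolution -/

section Tail

variable {w : ℕ → ℝ}

theorem tendsto_natCast_succ_rpow_neg {s : ℝ} (hs : 0 < s) :
    Tendsto (fun n : ℕ => ((n : ℝ) + 1) ^ (-s)) atTop (nhds 0) :=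
  (tendsto_rpow_neg_atTop hs).comp
    (tendsto_atTop_add_const_right _ _ tendsto_natCast_atTop_atTop)

theorem rpow_neg_sixth_pow {x : ℝ} (hx : 0 ≤ x) (k : ℕ) :
    (x ^ (-(1 / 6) : ℝ)) ^ k = x ^ (-(k / 6 : ℝ)) := by
  rw [← Real.rpow_natCast, ← Real.rpow_mul hx]
  congr 1
  ring

theorem natCast_rpow_neg_sixth_le_one (n : ℕ) : ((n : ℝ) + 1) ^ (-(1 / 6) : ℝ) ≤ 1 :=
  Real.rpow_le_one_of_one_le_of_nonpos (by linarith [(n.cast_nonneg : (0 : ℝ) ≤ n)]) (by norm_num)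

theorem rpow_neg_sixth_le_two_mul {x z : ℝ} (hx : 0 < x) (h : x / 2 ≤ z) :
    z ^ (-(1 / 6) : ℝ) ≤ 2 * x ^ (-(1 / 6) : ℝ) := by
  refine (Real.rpow_le_rpow_of_nonpos (by positivity) h (by norm_num)).trans ?_
  rw [Real.div_rpow (by positivity) (by norm_num), div_eq_inv_mul]
  refine mul_le_mul_of_nonneg_right ?_ (by positivity)
  rw [← Real.rpow_neg (by norm_num), neg_neg]
  exact (Real.rpow_le_rpow_of_exponent_le (by norm_num) (by norm_num : (1 / 6 : ℝ) ≤ 1)).trans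
    (Real.rpow_one 2).le

theorem quotient_le (hw : ∀ n : ℕ, |w n - ((n : ℝ) + 1) ^ (-(1 / 6) : ℝ)| ≤
    5 * (((n : ℝ) + 1) ^ (-(1 / 6) : ℝ)) ^ 3) (n : ℕ) :
    w n ≤ 6 * ((n : ℝ) + 1) ^ (-(1 / 6) : ℝ) := by
  have h1 := natCast_rpow_neg_sixth_le_one n
  have h0 : 0 < ((n : ℝ) + 1) ^ (-(1 / 6) : ℝ) := by positivity
  have h := (abs_le.1 (hw n)).2
  set y := ((n : ℝ) + 1) ^ (-(1 / 6) : ℝ)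
  have : y ^ 3 ≤ y := by
    calc y ^ 3 ≤ y ^ 1 := pow_le_pow_of_le_one h0.le h1 (by norm_num)
      _ = y := pow_one y
  linarith

/-- Passing from `j` to `j + m` at least doubles `j + 1`, which multiplies $(j+1)^{-1/6}$ by at most
$2^{-1/6}<9/10$; for large `j` the error terms fit between `9/10` and `19/20`. The finitely many
small `j` are handled by $w_n\to0$. -/
theorem exists_quotient_le_mul (hpos : ∀ n, 0 < w n)
    (hw : ∀ n : ℕ, |w n - ((n : ℝ) + 1) ^ (-(1 / 6) : ℝ)| ≤
      5 * (((n : ℝ) + 1) ^ (-(1 / 6) : ℝ)) ^ 3) :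
    ∃ M : ℕ, ∀ m ≥ M, ∀ j < m, w (j + m) ≤ 19 / 20 * w j := by
  have hy := tendsto_natCast_succ_rpow_neg (s := 1 / 6) (by norm_num)
  have hw0 : Tendsto w atTop (nhds 0) := by
    refine squeeze_zero (fun n => (hpos n).le) (quotient_le hw) ?_
    simpa using hy.const_mul 6
  obtain ⟨J, hJ⟩ := eventually_atTop.1 (hy.eventually (gt_mem_nhds (by norm_num : (0 : ℝ) < 1 / 20)))
  obtain ⟨c, hc, hcJ⟩ : ∃ c > 0, ∀ j < J, c ≤ w j := by
    clear hJ
    induction J with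
    | zero => exact ⟨1, one_pos, by simp⟩
    | succ J ih =>
      obtain ⟨c, hc, h⟩ := ih
      refine ⟨min c (w J), lt_min hc (hpos J), fun j hj => ?_⟩
      obtain hj | rfl := Nat.lt_succ_iff_lt_or_eq.1 hj
      · exact (min_le_left _ _).trans (h j hj)
      · exact min_le_right _ _
  obtain ⟨M, hM⟩ := eventually_atTop.1
    (hw0.eventually (gt_mem_nhds (by positivity : 0 < 19 / 20 * c)))
  refine ⟨M, fun m hm j hj => ?_⟩
  by_cases hjJ : j < J
  · have h1 := hM (j + m) (by omega)
    have h2 := hcJ j hjJ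
    linarith
  · have hyj := hJ j (by omega)
    have h1 := (abs_le.1 (hw j)).1
    have h2 := (abs_le.1 (hw (j + m))).2
    have hyj0 : 0 < ((j : ℝ) + 1) ^ (-(1 / 6) : ℝ) := by positivity
    have hz0 : 0 < (((j + m : ℕ) : ℝ) + 1) ^ (-(1 / 6) : ℝ) := by positivity
    have hzy : (((j + m : ℕ) : ℝ) + 1) ^ (-(1 / 6) : ℝ) ≤
        9 / 10 * ((j : ℝ) + 1) ^ (-(1 / 6) : ℝ) := by
      have hle : 2 * ((j : ℝ) + 1) ≤ ((j + m : ℕ) : ℝ) + 1 := by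
        have : (j : ℝ) + 1 ≤ m := by exact_mod_cast hj
        push_cast
        linarith
      refine (Real.rpow_le_rpow_of_nonpos (by positivity) hle (by norm_num)).trans ?_
      rw [Real.mul_rpow (by norm_num) (by positivity)]
      refine mul_le_mul_of_nonneg_right ?_ hyj0.le
      refine (pow_le_pow_iff_left₀ (by positivity) (by norm_num) (n := 6) (by norm_num)).1 ?_
      rw [rpow_neg_sixth_pow (by norm_num)]
      norm_num
    set y := ((j : ℝ) + 1) ^ (-(1 / 6) : ℝ)
    set z := (((j + m : ℕ) : ℝ) + 1) ^ (-(1 / 6) : ℝ)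
    -- As `y` and `z` are below `1/20`, the relative errors $5y^2$ and $5z^2$ are at most `1/80`.
    have hz2 : z ^ 2 ≤ 1 / 400 := by nlinarith
    have hy2 : y ^ 2 ≤ 1 / 400 := by nlinarith
    have hz3 : z ^ 3 ≤ 1 / 400 * z := by rw [pow_succ]; gcongr
    have hy3 : y ^ 3 ≤ 1 / 400 * y := by rw [pow_succ]; gcongr
    linarith

variable {α : ℕ → ℝ}

/-- Raising `i` by one multiplies the left-hand side by $w_{i+2+m}/w_{i+2}$, where
$w_n=\alpha_n/\alpha_{n+1}$. -/
theorem mul_div_le_geometric (hα : ∀ n, 0 < α n) {M : ℕ}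
    (hM : ∀ m ≥ M, ∀ j < m, α (j + m) / α (j + m + 1) ≤ 19 / 20 * (α j / α (j + 1)))
    {m : ℕ} (hm : M ≤ m) (i : ℕ) (hi : i + 2 ≤ m) :
    α (i + 2) * α m / α (i + 2 + m) ≤ (19 / 20) ^ i * (α 2 * α m / α (2 + m)) := by
  induction i with
  | zero => simp
  | succ i ih =>
    have h1 := ih (by omega)
    have h2 := hM m hm (i + 2) (by omega)
    have p1 := hα (i + 2)
    have p2 := hα (i + 3)
    have p3 := hα (i + 2 + m)
    have p4 := hα (i + 2 + m + 1)
    have p5 := hα m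
    have e : i + 1 + 2 + m = i + 2 + m + 1 := by ring
    rw [e, show i + 1 + 2 = i + 3 from rfl]
    have h3 : α (i + 3) * α m / α (i + 2 + m + 1) =
        α (i + 2) * α m / α (i + 2 + m) * (α (i + 2 + m) / α (i + 2 + m + 1)) *
          (α (i + 3) / α (i + 2)) := by
      field_simp
    have h4 : (19 / 20 * (α (i + 2) / α (i + 3))) * (α (i + 3) / α (i + 2)) = 19 / 20 := by
      field_simp
    calc α (i + 3) * α m / α (i + 2 + m + 1)
        = α (i + 2) * α m / α (i + 2 + m) * (α (i + 2 + m) / α (i + 2 + m + 1)) *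
          (α (i + 3) / α (i + 2)) := h3
      _ ≤ α (i + 2) * α m / α (i + 2 + m) * (19 / 20 * (α (i + 2) / α (i + 3))) *
          (α (i + 3) / α (i + 2)) := by gcongr
      _ = α (i + 2) * α m / α (i + 2 + m) * (19 / 20) := by rw [mul_assoc, h4]
      _ ≤ (19 / 20) ^ i * (α 2 * α m / α (2 + m)) * (19 / 20) := by gcongr
      _ = (19 / 20) ^ (i + 1) * (α 2 * α m / α (2 + m)) := by ring

/-- The middle part of a convolution is small for a sequence of rapid growth. -/
theorem exists_sum_mul_div_le (hα : ∀ n, 0 < α n)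
    (hw : ∀ n : ℕ, |α n / α (n + 1) - ((n : ℝ) + 1) ^ (-(1 / 6) : ℝ)| ≤
      5 * (((n : ℝ) + 1) ^ (-(1 / 6) : ℝ)) ^ 3) :
    ∃ K : ℝ, 0 ≤ K ∧ ∃ N₀ : ℕ, ∀ N ≥ N₀,
      ∑ i ∈ Finset.range (N + 1), α (i + 2) * α (N - i + 2) / α (N + 4) ≤
        K * (((N + 4 : ℕ) : ℝ) ^ (-(1 / 6) : ℝ)) ^ 2 := by
  obtain ⟨M, hM⟩ := exists_quotient_le_mul (w := fun n => α n / α (n + 1))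
    (fun n => div_pos (hα n) (hα _)) hw
  have half : ∀ (m i : ℕ), M ≤ m → i + 2 ≤ m → α (i + 2) * α m / α (i + 2 + m) ≤
      144 * α 2 * (19 / 20) ^ i * (((i + 2 + m : ℕ) : ℝ) ^ (-(1 / 6) : ℝ)) ^ 2 := by
    intro m i hm hi
    refine (mul_div_le_geometric hα hM hm i hi).trans ?_
    have q1 := quotient_le hw m
    have q2 := quotient_le hw (m + 1)
    have p0 := hα m
    have p1 := hα (m + 1)
    have p2 := hα (m + 2)
    have p3 := hα 2
    -- The end term contains two quotients $w_m$, $w_{m+1}$. Each is at most `12 * y`: the 6 comes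
    -- from `quotient_le`, and a factor 2 from `m` being at least half of `i + 2 + m`, up to a
    -- constant. This explains 144.
    have e : α 2 * α m / α (2 + m) = α 2 * ((α m / α (m + 1)) * (α (m + 1) / α (m + 1 + 1))) := by
      rw [add_comm 2 m]
      field_simp
    have hi' : (i : ℝ) + 2 ≤ m := by exact_mod_cast hi
    have c1 := rpow_neg_sixth_le_two_mul (x := ((i + 2 + m : ℕ) : ℝ)) (z := (m : ℝ) + 1)
      (by positivity) (by push_cast; linarith)
    have c2 := rpow_neg_sixth_le_two_mul (x := ((i + 2 + m : ℕ) : ℝ)) (z := ((m + 1 : ℕ) : ℝ) + 1)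
      (by positivity) (by push_cast; linarith)
    rw [e]
    set y := ((i + 2 + m : ℕ) : ℝ) ^ (-(1 / 6) : ℝ)
    have hy : 0 ≤ y := by positivity
    have d1 : α m / α (m + 1) ≤ 12 * y := by linarith
    have d2 : α (m + 1) / α (m + 1 + 1) ≤ 12 * y := by linarith
    calc (19 / 20 : ℝ) ^ i * (α 2 * ((α m / α (m + 1)) * (α (m + 1) / α (m + 1 + 1))))
        ≤ (19 / 20) ^ i * (α 2 * ((12 * y) * (12 * y))) := by gcongr
      _ = 144 * α 2 * (19 / 20) ^ i * y ^ 2 := by ring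
  -- Each of the two geometric series sums to at most 20; `N ≥ 2 * M` makes the larger index of
  -- every product at least `M`.
  refine ⟨144 * α 2 * 40, by linarith [hα 2], 2 * M, fun N hN => ?_⟩
  have hα2 := hα 2
  set y := ((N + 4 : ℕ) : ℝ) ^ (-(1 / 6) : ℝ)
  have hy : 0 ≤ y := by positivity
  have term : ∀ i ∈ Finset.range (N + 1), α (i + 2) * α (N - i + 2) / α (N + 4) ≤
      144 * α 2 * y ^ 2 * ((19 / 20) ^ i + (19 / 20) ^ (N - i)) := by
    intro i hi
    rw [Finset.mem_range] at hi
    have g1 : (0 : ℝ) ≤ (19 / 20) ^ i := by positivity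
    have g2 : (0 : ℝ) ≤ (19 / 20) ^ (N - i) := by positivity
    have g3 : 0 ≤ 144 * α 2 * y ^ 2 := by positivity
    obtain h | h := le_total i (N - i)
    · have := half (N - i + 2) i (by omega) (by omega)
      rw [show i + 2 + (N - i + 2) = N + 4 by omega] at this
      nlinarith [mul_nonneg g3 g2]
    · have := half (i + 2) (N - i) (by omega) (by omega)
      rw [show N - i + 2 + (i + 2) = N + 4 by omega, mul_comm (α (N - i + 2))] at this
      nlinarith [mul_nonneg g3 g1]
  have geom : ∑ i ∈ Finset.range (N + 1), (19 / 20 : ℝ) ^ i ≤ 20 := by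
    rw [geom_sum_eq (by norm_num), div_le_iff_of_neg (by norm_num)]
    have : (0 : ℝ) ≤ (19 / 20) ^ (N + 1) := by positivity
    linarith
  have geom' : ∑ i ∈ Finset.range (N + 1), (19 / 20 : ℝ) ^ (N - i) ≤ 20 := by
    have := Finset.sum_range_reflect (fun i => (19 / 20 : ℝ) ^ i) (N + 1)
    simp only [Nat.add_sub_cancel] at this
    rwa [this]
  refine (Finset.sum_le_sum term).trans ?_
  rw [← Finset.mul_sum, Finset.sum_add_distrib]
  have : 0 ≤ 144 * α 2 * y ^ 2 := by positivity
  nlinarith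

end Tail

/-! ### The recursion for the probabilities and its asymptotic solution -/

theorem prob_nonneg (n : ℕ) : 0 ≤ prob n := by
  rw [prob_eq]
  positivity

theorem prob_le_one (n : ℕ) : prob n ≤ 1 := by
  rw [prob_eq]
  exact div_le_one_of_le₀ (Nat.cast_le.2 (properCount_le n)) (by positivity)

theorem pairCoeff_eq (n : ℕ) :
    pairCoeff n = ((tau2Count n * tau3Count n : ℕ) : ℝ) / n.factorial := by
  rw [pairCoeff, coeff_tau3Series]
  push_cast
  ring

theorem prob_mul_pairCoeff (n : ℕ) :
    prob n * pairCoeff n = properCount n / n.factorial := by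
  have h : ((tau2Count n * tau3Count n : ℕ) : ℝ) ≠ 0 :=
    Nat.cast_ne_zero.2 (mul_pos (tau2Count_pos n) (tau3Count_pos n)).ne'
  rw [prob_eq, pairCoeff_eq]
  field_simp

theorem pairCoeff_succ (n : ℕ) : pairCoeff (n + 1) = ∑ k ∈ Finset.range (n + 1),
    ((k : ℝ) + 1) / (n + 1) * prob (k + 1) * (pairCoeff (k + 1) * pairCoeff (n - k)) := by
  rw [pairCoeff_eq, tau2Count_mul_tau3Count_succ, Nat.cast_sum, Finset.sum_div]
  refine Finset.sum_congr rfl fun k hk => ?_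
  rw [mul_assoc, ← mul_assoc (prob (k + 1)), prob_mul_pairCoeff, pairCoeff_eq]
  have hk' : k ≤ n := by simpa [Nat.lt_succ_iff] using hk
  push_cast
  rw [Nat.cast_choose ℝ hk', Nat.factorial_succ, Nat.factorial_succ]
  push_cast
  field_simp

theorem pairCoeff_one : pairCoeff 1 = 1 := by
  simp [pairCoeff, tau2Count_one, coeff_tau3Series_one]

theorem pairCoeff_zero : pairCoeff 0 = 1 := by
  simp [pairCoeff, tau2Count_zero, coeff_tau3Series_zero]

theorem one_div_natCast_le_rpow {n : ℕ} (hn : 1 ≤ n) :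
    1 / (n : ℝ) ≤ (n : ℝ) ^ (-(1 / 6) : ℝ) := by
  rw [one_div, ← Real.rpow_neg_one]
  exact Real.rpow_le_rpow_of_exponent_le (by exact_mod_cast hn) (by norm_num)

theorem abs_pairCoeff_div_sub_rpow_le (n : ℕ) :
    |pairCoeff n / pairCoeff (n + 1) - ((n : ℝ) + 1) ^ (-(1 / 6) : ℝ)| ≤
      5 * (((n : ℝ) + 1) ^ (-(1 / 6) : ℝ)) ^ 3 := by
  have h0 : (0 : ℝ) ≤ n + 1 := by positivity
  have := abs_pairCoeff_div_sub_le n (y := ((n : ℝ) + 1) ^ (1 / 6 : ℝ)) (by positivity) (by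
    rw [← Real.rpow_natCast, ← Real.rpow_mul h0]
    norm_num)
  rwa [← Real.rpow_neg h0] at this

theorem exists_abs_one_sub_prob_sub_le : ∃ K : ℝ, 0 ≤ K ∧ ∃ N₀ : ℕ, ∀ N ≥ N₀,
    |(1 - prob (N + 4)) - (N + 3) / (N + 4) * prob (N + 3) *
        (pairCoeff (N + 3) / pairCoeff (N + 4))| ≤
      K * (((N + 4 : ℕ) : ℝ) ^ (-(1 / 6) : ℝ)) ^ 2 := by
  have hw := abs_pairCoeff_div_sub_rpow_le
  obtain ⟨K, hK, N₀, h⟩ := exists_sum_mul_div_le pairCoeff_pos hw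
  refine ⟨K + 6, by linarith, N₀, fun N hN => ?_⟩
  have hN := h N hN
  have hq := quotient_le hw (N + 3)
  have hp3 := pairCoeff_pos (N + 3)
  have hp4 := pairCoeff_pos (N + 4)
  have hrec := pairCoeff_succ (N + 3)
  have h1 : prob 1 ≤ 1 := prob_le_one 1
  have h1' : 0 ≤ prob 1 := prob_nonneg 1
  have hmid : ∀ i ∈ Finset.range (N + 1), N + 3 - (i + 1) = N - i + 2 := by
    intro i hi
    rw [Finset.mem_range] at hi
    omega
  -- The terms `k = N + 3`, `k = N + 2` and `k = 0` are split off; in the remaining products both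
  -- indices are at least 2.
  rw [Finset.sum_range_succ, Finset.sum_range_succ, Finset.sum_range_succ',
    Finset.sum_congr rfl fun i hi => by rw [hmid i hi]] at hrec
  simp only [show N + 3 - (N + 3) = 0 by omega, show N + 3 - (N + 2) = 1 by omega, pairCoeff_one,
    pairCoeff_zero, Nat.sub_zero, Nat.cast_zero, zero_add, mul_one, one_mul] at hrec
  set S := ∑ i ∈ Finset.range (N + 1), (((i + 1 : ℕ) : ℝ) + 1) / (((N + 3 : ℕ) : ℝ) + 1) *
    prob (i + 1 + 1) * (pairCoeff (i + 1 + 1) * pairCoeff (N - i + 2)) with hS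
  have hS0 : 0 ≤ S / pairCoeff (N + 4) := by
    refine div_nonneg (Finset.sum_nonneg fun i _ => ?_) hp4.le
    have := prob_nonneg (i + 1 + 1)
    have := pairCoeff_pos (i + 1 + 1)
    have := pairCoeff_pos (N - i + 2)
    positivity
  have hS1 : S / pairCoeff (N + 4) ≤ K * (((N + 4 : ℕ) : ℝ) ^ (-(1 / 6) : ℝ)) ^ 2 := by
    refine le_trans ?_ hN
    rw [hS, Finset.sum_div]
    refine Finset.sum_le_sum fun i hi => ?_
    refine div_le_div_of_nonneg_right ?_ hp4.le
    have a1 := prob_le_one (i + 1 + 1)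
    have a0 := prob_nonneg (i + 1 + 1)
    have a2 := pairCoeff_pos (i + 1 + 1)
    have a3 := pairCoeff_pos (N - i + 2)
    have a4 : (((i + 1 : ℕ) : ℝ) + 1) / (((N + 3 : ℕ) : ℝ) + 1) ≤ 1 := by
      rw [div_le_one (by positivity)]
      have : (i : ℝ) ≤ N := by exact_mod_cast Nat.lt_succ_iff.1 (Finset.mem_range.1 hi)
      push_cast
      linarith
    exact mul_le_of_le_one_left (by positivity) (mul_le_one₀ a4 a0 a1)
  have hid : (1 - prob (N + 4)) - (N + 3) / (N + 4) * prob (N + 3) *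
        (pairCoeff (N + 3) / pairCoeff (N + 4)) = S / pairCoeff (N + 4) +
      1 / (N + 4) * prob 1 * (pairCoeff (N + 3) / pairCoeff (N + 4)) := by
    have e : (((N + 3 : ℕ) : ℝ) + 1) = N + 4 := by push_cast; ring
    have e' : (((N + 2 : ℕ) : ℝ) + 1) = N + 3 := by push_cast; ring
    have hN4 : (N : ℝ) + 4 ≠ 0 := by positivity
    rw [e, e', div_self hN4, show N + 3 + 1 = N + 4 from rfl, show N + 2 + 1 = N + 3 from rfl,
      one_mul] at hrec
    have hS' : S = pairCoeff (N + 4) - 1 / (N + 4) * prob 1 * pairCoeff (N + 3) -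
        (N + 3) / (N + 4) * prob (N + 3) * pairCoeff (N + 3) -
        prob (N + 4) * pairCoeff (N + 4) := by linarith
    rw [hS']
    have := hp4.ne'
    field_simp
    ring
  rw [hid]
  have e : (((N + 3 : ℕ) : ℝ) + 1) = ((N + 4 : ℕ) : ℝ) := by push_cast; ring
  rw [e] at hq
  have hy0 : 0 < ((N + 4 : ℕ) : ℝ) ^ (-(1 / 6) : ℝ) := by positivity
  have hinv : 1 / ((N : ℝ) + 4) ≤ ((N + 4 : ℕ) : ℝ) ^ (-(1 / 6) : ℝ) := by
    have := one_div_natCast_le_rpow (n := N + 4) (by omega)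
    push_cast at this ⊢
    exact this
  have hqpos := div_pos hp3 hp4
  rw [show N + 3 + 1 = N + 4 from rfl] at hq
  set y := ((N + 4 : ℕ) : ℝ) ^ (-(1 / 6) : ℝ)
  -- The term `k = 0` accounts for the 6 in `K + 6`; the crude bound $1/n\le n^{-1/6}$ suffices.
  have hfirst : 1 / ((N : ℝ) + 4) * prob 1 * (pairCoeff (N + 3) / pairCoeff (N + 4)) ≤
      y * 1 * (6 * y) := by
    gcongr
  have hfirst0 : 0 ≤ 1 / ((N : ℝ) + 4) * prob 1 * (pairCoeff (N + 3) / pairCoeff (N + 4)) :=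
    mul_nonneg (mul_nonneg (by positivity) h1') hqpos.le
  rw [abs_of_nonneg (add_nonneg hS0 hfirst0)]
  linarith

theorem one_sub_prob_isBigO :
    (fun n : ℕ => prob n - (1 - (n : ℝ) ^ (-(1 / 6) : ℝ)))
      =O[atTop] (fun n : ℕ => (n : ℝ) ^ (-(1 / 3) : ℝ)) := by
  obtain ⟨K, hK, N₀, h⟩ := exists_abs_one_sub_prob_sub_le
  -- The first pass of the bootstrap uses only $p_{n-1}\le1$.
  have hfirst : ∀ N ≥ N₀, 1 - prob (N + 4) ≤ (K + 6) * ((N + 4 : ℕ) : ℝ) ^ (-(1 / 6) : ℝ) := by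
    intro N hN
    have h1 := (abs_le.1 (h N hN)).2
    have hq := quotient_le abs_pairCoeff_div_sub_rpow_le (N + 3)
    have e : (((N + 3 : ℕ) : ℝ) + 1) = ((N + 4 : ℕ) : ℝ) := by push_cast; ring
    have hy1 := natCast_rpow_neg_sixth_le_one (N + 3)
    rw [e] at hq hy1
    have hy0 : 0 < ((N + 4 : ℕ) : ℝ) ^ (-(1 / 6) : ℝ) := by positivity
    have hqpos := div_pos (pairCoeff_pos (N + 3)) (pairCoeff_pos (N + 4))
    rw [show N + 3 + 1 = N + 4 from rfl] at hq
    set y := ((N + 4 : ℕ) : ℝ) ^ (-(1 / 6) : ℝ)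
    have hc : ((N : ℝ) + 3) / (N + 4) ≤ 1 := by
      rw [div_le_one (by positivity)]
      linarith
    have hc' : ((N : ℝ) + 3) / (N + 4) * prob (N + 3) ≤ 1 :=
      mul_le_one₀ hc (prob_nonneg _) (prob_le_one _)
    have h2 : ((N : ℝ) + 3) / (N + 4) * prob (N + 3) * (pairCoeff (N + 3) / pairCoeff (N + 4)) ≤
        1 * (6 * y) := by gcongr
    have h3 : y ^ 2 ≤ y := by nlinarith
    nlinarith
  -- `K` bounds the remainder of the recursion, 5 the error of the quotient `q`, and the last
  -- summand the effect of replacing $(1-\frac1n)p_{n-1}$ by 1.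
  refine IsBigO.of_bound (K + 5 + 6 * (1 + 2 * (K + 6))) ?_
  filter_upwards [eventually_ge_atTop (N₀ + 5)] with n hn
  -- The shift by 5 makes the first-pass bound available at the preceding index `N + 4`.
  obtain ⟨N, rfl⟩ : ∃ N, n = N + 1 + 4 := ⟨n - 5, by omega⟩
  have hN : N₀ ≤ N + 1 := by omega
  have h1 := abs_le.1 (h (N + 1) hN)
  have hδ := hfirst N (by omega)
  have hδ0 : 0 ≤ 1 - prob (N + 4) := by linarith [prob_le_one (N + 4)]
  have hw := abs_le.1 (abs_pairCoeff_div_sub_rpow_le (N + 4))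
  have hq := quotient_le abs_pairCoeff_div_sub_rpow_le (N + 4)
  have e : (((N + 4 : ℕ) : ℝ) + 1) = ((N + 1 + 4 : ℕ) : ℝ) := by push_cast; ring
  have hy1 := natCast_rpow_neg_sixth_le_one (N + 4)
  rw [e] at hq hy1 hw
  rw [show N + 4 + 1 = N + 1 + 4 from by ring] at hq hw
  rw [show N + 1 + 3 = N + 4 from by ring] at h1
  have hqpos := div_pos (pairCoeff_pos (N + 4)) (pairCoeff_pos (N + 1 + 4))
  have hinv := one_div_natCast_le_rpow (n := N + 1 + 4) (by omega)
  have hcmp : ((N + 4 : ℕ) : ℝ) ^ (-(1 / 6) : ℝ) ≤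
      2 * ((N + 1 + 4 : ℕ) : ℝ) ^ (-(1 / 6) : ℝ) := by
    have hle : ((N + 1 + 4 : ℕ) : ℝ) / 2 ≤ ((N + 4 : ℕ) : ℝ) := by
      push_cast
      linarith [(N.cast_nonneg : (0 : ℝ) ≤ N)]
    exact rpow_neg_sixth_le_two_mul (by positivity) hle
  have hc : (((N + 1 : ℕ) : ℝ) + 3) / (((N + 1 : ℕ) : ℝ) + 4) = 1 - 1 / ((N + 1 + 4 : ℕ) : ℝ) := by
    push_cast
    field_simp
    ring
  rw [hc] at h1
  have hy0 : 0 < ((N + 1 + 4 : ℕ) : ℝ) ^ (-(1 / 6) : ℝ) := by positivity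
  have hy2 : ((N + 1 + 4 : ℕ) : ℝ) ^ (-(1 / 3) : ℝ) =
      (((N + 1 + 4 : ℕ) : ℝ) ^ (-(1 / 6) : ℝ)) ^ 2 := by
    rw [rpow_neg_sixth_pow (by positivity)]
    norm_num
  rw [hy2, Real.norm_eq_abs, Real.norm_of_nonneg (by positivity)]
  have hinv0 : 0 ≤ 1 / ((N + 1 + 4 : ℕ) : ℝ) := by positivity
  have hinv1 : 1 / ((N + 1 + 4 : ℕ) : ℝ) ≤ 1 := hinv.trans hy1
  set y := ((N + 1 + 4 : ℕ) : ℝ) ^ (-(1 / 6) : ℝ)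
  set v := 1 / ((N + 1 + 4 : ℕ) : ℝ)
  set q := pairCoeff (N + 4) / pairCoeff (N + 1 + 4)
  set d := 1 - prob (N + 4) with hd
  have hprob : prob (N + 4) = 1 - d := by rw [hd]; ring
  rw [hprob] at h1
  have hd2 : d ≤ 2 * (K + 6) * y := by nlinarith
  have hy3 : y ^ 3 ≤ y ^ 2 := pow_le_pow_of_le_one hy0.le hy1 (by norm_num)
  have hb0 : 0 ≤ v + d - v * d := by nlinarith
  have hb : v + d - v * d ≤ (1 + 2 * (K + 6)) * y := by nlinarith [mul_nonneg hinv0 hδ0]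
  have hprod : (v + d - v * d) * q ≤ ((1 + 2 * (K + 6)) * y) * (6 * y) :=
    mul_le_mul hb hq hqpos.le (by positivity)
  have hprod0 : 0 ≤ (v + d - v * d) * q := mul_nonneg hb0 hqpos.le
  have hexp : (1 - v) * (1 - d) * q = q - (v + d - v * d) * q := by ring
  rw [hexp] at h1
  rw [abs_le]
  constructor <;> nlinarith

end PSL2Z

end

theorem mainTheorem2 :
    (∀ (n : ℕ) (S : PSL2Z.Tau2Structure (Fin n)) (T : PSL2Z.Tau3Structure (Fin n)),
      (PSL2Z.graphOf S T).IsProperCyclicallyReduced ↔ (PSL2Z.graphOf S T).IsConnected) ∧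
    (∀ n : ℕ, 1 ≤ n →
      PowerSeries.coeff n (PSL2Z.atOne PSL2Z.GprTilde) ≠ 0 ∧
      PSL2Z.prob n =
        PowerSeries.coeff n (PSL2Z.atOne PSL2Z.Gpr) /
          PowerSeries.coeff n (PSL2Z.atOne PSL2Z.GprTilde)) ∧
    (fun n : ℕ => PSL2Z.prob n - (1 - (n : ℝ) ^ (-(1 / 6) : ℝ)))
      =O[atTop] (fun n : ℕ => (n : ℝ) ^ (-(1 / 3) : ℝ)) := by
  refine ⟨fun n S T => ?_, fun n hn => ?_, PSL2Z.one_sub_prob_isBigO⟩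
  · rw [PSL2Z.isProperCyclicallyReduced_iff]
    exact and_iff_right (PSL2Z.graphOf_hasProps S T)
  · have hfact : (n.factorial : ℝ) ≠ 0 := by positivity
    have hpos : ((PSL2Z.tau2Count n * PSL2Z.tau3Count n : ℕ) : ℝ) ≠ 0 :=
      Nat.cast_ne_zero.2 (mul_pos (PSL2Z.tau2Count_pos n) (PSL2Z.tau3Count_pos n)).ne'
    rw [PSL2Z.coeff_atOne_GprTilde hn, PSL2Z.coeff_atOne_Gpr, PSL2Z.prob_eq]
    exact ⟨div_ne_zero hpos hfact, (div_div_div_cancel_right₀ hfact _ _).symm⟩
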